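/- **Setting.** Let $I\ge 2$, $J,K,L,M,N\ge 1$ be integers, $\Omega=\{1,\dots,I\}$ with probabilities $p_i>0$, $\sum_i p_i=1$. For a random vector $u=(u_i)_{i\in\Omega}$ put $\mathbb E[u]=\sum_i p_iu_i$. Let $\mathcal L^J$ be the space of random vectors $u=(u_i)_{i\in\Omega}$, $u_i\in\mathbb R^J$, and let $R:\mathcal L^J\to 2^{\mathbb R^J}$ be a multivariate convex risk measure: $R(u)\supseteq R(u')$ if $u\le u'$; $R(u+z)=R(u)+z$ for $z\in\mathbb R^J$; $R(u)\notin\{\emptyset,\mathbb R^J\}$; $R(cu+(1-c)u')\supseteq cR(u)+(1-c)R(u')$ for $0<c<1$; and $\mathcal A=\{u: 0\in R(u)\}$ is closed. Let $A\in\mathbb R^{K\times M}$, $b\in\mathbb R^K$, $C\in\mathbb R^{J\times M}$, $T_i\in\mathbb R^{L\times M}$, $W_i\in\mathbb R^{L\times N}$, $h_i\in\mathbb R^L$, $Q_i\in\mathbb R^{J\times N}$ ($i\in\Omega$), and $$\mathcal F_i=\{(x,y)\in\mathbb R^M_+\times\mathbb R^N_+: Ax=b,\ T_ix+W_iy=h_i\},$$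 $$\mathcal X=\{(x,(y_i)_i): (x,y_i)\in\mathcal F_i\ \ \forall i\in\Omega\}.$$ For $x=(x_i)_i$, $y=(y_i)_i$ let $Cx+Qy$ be the random vector with realizations $Cx_i+Q_iy_i$ (a deterministic $x$ has $x_i=x$). Assume that $\mathcal X$ is nonempty and compact. Let $v\in\mathbb R^J\setminus \mathrm{cl}\bigcup_{(x,y)\in\mathcal X}R(Cx+Qy)$ and $$\mathscr P_2(v)=\inf\{\alpha\in\mathbb R: v+\alpha\mathbf 1\in R(Cx+Qy)\text{ for some }(x,y)\in\mathcal X\}.$$ For $m=(m_i)_i$ with $m_i\in\mathbb R^J_+$ (a vector of finite measures) and $\lambda=(\lambda_i)_i$ with $\lambda_i\in\mathbb R^M$, let $$\tilde\beta(m)=\sup_{u\in\mathcal A}\sum_i m_i^{\mathsf T}u_i,\qquad \tilde f_i(m_i,\lambda_i)=\inf_{(x,y)\in\mathcal F_i}\big(m_i^{\mathsf T}(Cx+Q_iy)+p_i\lambda_i^{\mathsf T}x\big),$$ $$F(m,\lambda)=\sum_i\tilde f_i(m_i,\lambda_i)-\tilde\beta(m)-\sum_i m_i^{\mathsf T}v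 .$$ Call $(m,\lambda)$ *dual feasible* if $m_i\in\mathbb R^J_+$ for all $i$, $\sum_i m_i^{\mathsf T}\mathbf 1=1$ and $\mathbb E[\lambda]=0$. The dual problem $(D_2(v))$ is to maximize $F$ over the dual feasible points. **Dual bundle method.** Fix $\varrho>0$, $\gamma\in(0,1)$ and a dual feasible starting point $(m^{(1)},\lambda^{(1)})$. Iteration $k=1,2,\dots$ consists of the following steps. 1. For each $i$, compute an optimal solution $(x_i^{(k)},y_i^{(k)})$ of the problem defining $\tilde f_i(m^{(k)}_i,\lambda^{(k)}_i)$. Set $g_{m_i^{(k)}}=Cx_i^{(k)}+Q_iy_i^{(k)}$ and $g_{\lambda_i^{(k)}}=p_ix_i^{(k)}$. 2. Compute $\tilde\beta(m^{(k)})<\infty$ and a subgradient $\rho^{(k)}=(\rho_i^{(k)})_i$ of the concave function $-\tilde\beta$ at $m^{(k)}$: $-\tilde\beta(m)\le-\tilde\beta(m^{(k)})+\sum_i(\rho^{(k)}_i)^{\mathsf T}(m_i-m_i^{(k)})$ for all vectors $m$ of finite measures. 3. Call iteration $k$ a *descent iteration* if $k=1$, or if $k\ge2$ and $F(m^{(k)},\lambda^{(k)})\ge(1-\gamma)\bar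 F^{(k)}+\gamma\big(\sum_i\vartheta_i^{(k)}+\eta^{(k)}-\sum_i(m_i^{(k)})^{\mathsf T}v\big)$, where $\bar F^{(k)}=F(\bar m^{(k-1)},\bar\lambda^{(k-1)})$. In a descent iteration set the centers $(\bar m^{(k)},\bar\lambda^{(k)})=(m^{(k)},\lambda^{(k)})$; otherwise set $(\bar m^{(k)},\bar\lambda^{(k)})=(\bar m^{(k-1)},\bar\lambda^{(k-1)})$. 4. Let $(m^{(k+1)},\lambda^{(k+1)},\vartheta^{(k+1)},\eta^{(k+1)})$ be an optimal solution of the master problem with centers $(\bar m^{(k)},\bar\lambda^{(k)})$ and index set $\mathcal L=\{1,\dots,k\}$, namely: maximize $$\sum_i\vartheta_i+\eta-\sum_i m_i^{\mathsf T}v-\varrho\sum_i\|m_i-\bar m_i^{(k)}\|^2-\varrho\sum_i\|\lambda_i-\bar\lambda_i^{(k)}\|^2$$ over $(m,\lambda,\vartheta,\eta)$ subject to - (i) $\vartheta_i\le\tilde f_i(m_i^{(\ell)},\lambda_i^{(\ell)})+g_{m_i^{(\ell)}}^{\mathsf T}(m_i-m_i^{(\ell)})+g_{\lambda_i^{(\ell)}}^{\mathsf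 T}(\lambda_i-\lambda_i^{(\ell)})$ for $i\in\Omega$, $\ell\in\mathcal L$; - (ii) $\eta\le-\tilde\beta(m^{(\ell)})+\sum_i(\rho_i^{(\ell)})^{\mathsf T}(m_i-m_i^{(\ell)})$ for $\ell\in\mathcal L$; - (iii) $\sum_ip_i\lambda_i=0$; (iv) $\sum_im_i^{\mathsf T}\mathbf 1=1$; (v) $m_i\in\mathbb R^J_+$ for $i\in\Omega$. For $\varepsilon>0$, the method stops at the first iteration $k$ with $\sum_i\vartheta_i^{(k+1)}+\eta^{(k+1)}-\sum_i(m_i^{(k+1)})^{\mathsf T}v-\bar F^{(k+1)}\le\varepsilon$. **Recovery.** Suppose that the method with tolerance $\varepsilon>0$ stops at iteration $k$ and that, when the iterations are continued, $n+1$ (with $n\ge k$) is the first descent iteration after $k$. Let $\mathcal L'=\{1,\dots,n\}$ and let $(\tau,\theta,\sigma,\psi,\nu)$, with $\tau_i^{(\ell)}\ge0$, $\theta^{(\ell)}\ge0$, $\sigma\in\mathbb R^M$, $\psi\in\mathbb R$, $\nu_i\in\mathbb R^J_+$, be any optimal solution of the Lagrangian dual of the master problem with centers $(\bar m^{(k)},\bar\lambda^{(k)})$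 and index set $\mathcal L'$. Here $\tau,\theta,\sigma,\psi,\nu$ are the multipliers of (i)–(v), and the Lagrangian is the objective plus $\sum_{i,\ell}\tau_i^{(\ell)}(\text{rhs}-\text{lhs of (i)})+\sum_\ell\theta^{(\ell)}(\text{rhs}-\text{lhs of (ii)})-\sigma^{\mathsf T}\sum_ip_i\lambda_i+\psi(1-\sum_im_i^{\mathsf T}\mathbf 1)+\sum_i\nu_i^{\mathsf T}m_i$; the dual objective is its supremum over all $(m,\lambda,\vartheta,\eta)$. Define $$(x_{(v)})_i=\sum_{\ell\in\mathcal L'}\tau_i^{(\ell)}x_i^{(\ell)},\qquad (y_{(v)})_i=\sum_{\ell\in\mathcal L'}\tau_i^{(\ell)}y_i^{(\ell)},$$ $$\alpha_{(v)}=\inf\{\alpha\in\mathbb R: v+\alpha\mathbf 1\in R(Cx_{(v)}+Qy_{(v)})\}.$$ **Theorem.** $\mathscr P_2(v)$ is finite, and in every such situation: (a) $((x_{(v)})_i,(y_{(v)})_i)\in\mathcal F_i$ for each $i\in\Omega$; (b) $v+\alpha_{(v)}\mathbf 1\in R(Cx_{(v)}+Qy_{(v)})$; that is, the infimum defining $\alpha_{(v)}$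 is attained. Moreover, as $\varepsilon\to0$: (c) $(x_{(v)})_i-\sigma\to0$ for each $i\in\Omega$; (d) $\alpha_{(v)}\to\mathscr P_2(v)$. The limits (c), (d) are meant as follows: for every $\delta>0$ there is $\varepsilon_0>0$, depending only on $\delta$, the problem data, $v,\varrho,\gamma$ and the starting point, such that for all $0<\varepsilon<\varepsilon_0$, all runs of the method from that starting point, and all $k,n,(\tau,\theta,\sigma,\psi,\nu)$ as above, the quantities $\|(x_{(v)})_i-\sigma\|$ ($i\in\Omega$) and $|\alpha_{(v)}-\mathscr P_2(v)|$ are less than $\delta$. -/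

import Mathlib

open scoped Matrix

/-- Axioms of a multivariate convex risk measure on the finite sample space `Fin I`; a random
vector is a function `Fin I → Fin J → ℝ`. -/
structure IsMultivariateConvexRiskMeasure {I J : ℕ}
    (R : (Fin I → Fin J → ℝ) → Set (Fin J → ℝ)) : Prop where
  monotone : ∀ u u' : Fin I → Fin J → ℝ, u ≤ u' → R u' ⊆ R u
  translative : ∀ (u : Fin I → Fin J → ℝ) (z : Fin J → ℝ),
    R (fun i => u i + z) = (fun a => a + z) '' R u
  finite : ∀ u : Fin I → Fin J → ℝ, R u ≠ ∅ ∧ R u ≠ Set.univ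
  convex : ∀ (u u' : Fin I → Fin J → ℝ) (c : ℝ), 0 < c → c < 1 →
    ∀ a ∈ R u, ∀ a' ∈ R u', c • a + (1 - c) • a' ∈ R (c • u + (1 - c) • u')
  closed : IsClosed {u : Fin I → Fin J → ℝ | (0 : Fin J → ℝ) ∈ R u}

/-- The acceptance set of a set-valued risk measure. -/
def acceptanceSet {I J : ℕ} (R : (Fin I → Fin J → ℝ) → Set (Fin J → ℝ)) :
    Set (Fin I → Fin J → ℝ) :=
  {u | (0 : Fin J → ℝ) ∈ R u}

/-- The penalty function on vectors of finite measures: the support function of the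
acceptance set. -/
noncomputable def penalty {I J : ℕ} (R : (Fin I → Fin J → ℝ) → Set (Fin J → ℝ))
    (m : Fin I → Fin J → ℝ) : EReal :=
  ⨆ u ∈ acceptanceSet R, ((∑ i, m i ⬝ᵥ u i : ℝ) : EReal)

/-- `g` is a subgradient, at `m'`, of the concave function `-penalty R` on the cone of vectors of
finite measures (that is, `-penalty R` is finite at `m'` and bounded above by the affine function
with slope `g` through its value at `m'`). -/
def IsPenaltySubgradient {I J : ℕ} (R : (Fin I → Fin J → ℝ) → Set (Fin J → ℝ))
    (m' g : Fin I → Fin J → ℝ) : Prop :=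
  penalty R m' ≠ ⊤ ∧
    ∀ m : Fin I → Fin J → ℝ, 0 ≤ m →
      -penalty R m ≤ -penalty R m' + ((∑ i, g i ⬝ᵥ (m i - m' i) : ℝ) : EReal)

/-- The data of a multi-objective two-stage stochastic program: scenario probabilities `p`,
first-stage constraint `A x = b`, first-stage cost matrix `C`, second-stage constraints
`T i x + W i y = h i` and second-stage cost matrices `Q i`. -/
structure StochProgram (I J K L M N : ℕ) where
  p : Fin I → ℝ
  A : Matrix (Fin K) (Fin M) ℝ
  b : Fin K → ℝ
  C : Matrix (Fin J) (Fin M) ℝ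
  T : Fin I → Matrix (Fin L) (Fin M) ℝ
  W : Fin I → Matrix (Fin L) (Fin N) ℝ
  h : Fin I → Fin L → ℝ
  Q : Fin I → Matrix (Fin J) (Fin N) ℝ

/-- The sequences produced by the dual bundle method. The iteration number is the natural-number
argument and starts at `1`; values at `0` (and `vartheta 1`, `eta 1`) play no role. -/
structure BundleIterates (I J M N : ℕ) where
  m : ℕ → Fin I → Fin J → ℝ
  lam : ℕ → Fin I → Fin M → ℝ
  vartheta : ℕ → Fin I → ℝ
  eta : ℕ → ℝ
  /-- computed solutions of the scenario subproblems -/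
  x : ℕ → Fin I → Fin M → ℝ
  y : ℕ → Fin I → Fin N → ℝ
  /-- computed subgradients of the negative penalty -/
  rho : ℕ → Fin I → Fin J → ℝ
  /-- centers -/
  mbar : ℕ → Fin I → Fin J → ℝ
  lambar : ℕ → Fin I → Fin M → ℝ

/-- Variables of the master problem. -/
structure MasterPoint (I J M : ℕ) where
  m : Fin I → Fin J → ℝ
  lam : Fin I → Fin M → ℝ
  vartheta : Fin I → ℝ
  eta : ℝ

/-- Lagrange multipliers of the master problem: `tau i l` and `theta l` for the cuts with index
`l`, `sigma` for `∑ p i • lam i = 0`, `psi` for total mass one, `nu` for `m ≥ 0`. -/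
structure MasterMultipliers (I J M : ℕ) where
  tau : Fin I → ℕ → ℝ
  theta : ℕ → ℝ
  sigma : Fin M → ℝ
  psi : ℝ
  nu : Fin I → Fin J → ℝ

namespace StochProgram

variable {I J K L M N : ℕ} (D : StochProgram I J K L M N)

/-- Feasible set of the program with a deterministic first-stage decision. -/
def feasibleSet : Set ((Fin M → ℝ) × (Fin I → Fin N → ℝ)) :=
  {z | 0 ≤ z.1 ∧ 0 ≤ z.2 ∧ D.A *ᵥ z.1 = D.b ∧
    ∀ i, D.T i *ᵥ z.1 + D.W i *ᵥ z.2 i = D.h i}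

/-- Feasible set of scenario `i`. -/
def scenarioSet (i : Fin I) : Set ((Fin M → ℝ) × (Fin N → ℝ)) :=
  {z | 0 ≤ z.1 ∧ 0 ≤ z.2 ∧ D.A *ᵥ z.1 = D.b ∧ D.T i *ᵥ z.1 + D.W i *ᵥ z.2 = D.h i}

/-- The random total cost `C x + Q y`, for a randomized first-stage decision `x`. -/
def cost (x : Fin I → Fin M → ℝ) (y : Fin I → Fin N → ℝ) : Fin I → Fin J → ℝ :=
  fun i => D.C *ᵥ x i + D.Q i *ᵥ y i

/-- The upper image of the vector optimization problem. -/
def upperImage (R : (Fin I → Fin J → ℝ) → Set (Fin J → ℝ)) : Set (Fin J → ℝ) :=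
  closure (⋃ z ∈ D.feasibleSet, R (D.cost (fun _ => z.1) z.2))

/-- The step lengths `α` for which `v + α 1` lies in `R (C x + Q y)`. -/
def steps (R : (Fin I → Fin J → ℝ) → Set (Fin J → ℝ)) (v : Fin J → ℝ)
    (x : Fin I → Fin M → ℝ) (y : Fin I → Fin N → ℝ) : Set ℝ :=
  {α | (fun j => v j + α) ∈ R (D.cost x y)}

/-- The feasible values of the scalarization by the reference variable `v`. -/
def refValues (R : (Fin I → Fin J → ℝ) → Set (Fin J → ℝ)) (v : Fin J → ℝ) : Set ℝ :=
  {α | ∃ z ∈ D.feasibleSet, α ∈ D.steps R v (fun _ => z.1) z.2}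

/-- Optimal value of the scalarization by the reference variable `v`. -/
noncomputable def refValue (R : (Fin I → Fin J → ℝ) → Set (Fin J → ℝ)) (v : Fin J → ℝ) : ℝ :=
  sInf (D.refValues R v)

/-- Objective of the subproblem of scenario `i` at the dual point `(mi, li)`. -/
def subObjective (i : Fin I) (mi : Fin J → ℝ) (li : Fin M → ℝ)
    (z : (Fin M → ℝ) × (Fin N → ℝ)) : ℝ :=
  mi ⬝ᵥ (D.C *ᵥ z.1 + D.Q i *ᵥ z.2) + D.p i * (li ⬝ᵥ z.1)

/-- Optimal value of the subproblem of scenario `i` at the dual point `(mi, li)`. -/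
noncomputable def subValue (i : Fin I) (mi : Fin J → ℝ) (li : Fin M → ℝ) : ℝ :=
  sInf (D.subObjective i mi li '' D.scenarioSet i)

/-- Feasibility for the dual problem solved by the bundle method: `m` is a vector of finite
measures of total mass one, and `lam` has expectation zero. -/
def IsDualFeasible (m : Fin I → Fin J → ℝ) (lam : Fin I → Fin M → ℝ) : Prop :=
  0 ≤ m ∧ ∑ i, ∑ j, m i j = 1 ∧ ∑ i, D.p i • lam i = 0

/-- Objective of the dual problem (meaningful where the penalty is finite). -/
noncomputable def dualObjective (R : (Fin I → Fin J → ℝ) → Set (Fin J → ℝ)) (v : Fin J → ℝ)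
    (m : Fin I → Fin J → ℝ) (lam : Fin I → Fin M → ℝ) : ℝ :=
  ∑ i, D.subValue i (m i) (lam i) - (penalty R m).toReal - ∑ i, m i ⬝ᵥ v

/-- Right-hand side of the cut with index `l` for the value function of scenario `i`, with the
subgradient given by the computed solution of the subproblem. -/
noncomputable def scenarioCut (s : BundleIterates I J M N) (l : ℕ) (i : Fin I)
    (mi : Fin J → ℝ) (li : Fin M → ℝ) : ℝ :=
  D.subValue i (s.m l i) (s.lam l i)
    + (D.C *ᵥ s.x l i + D.Q i *ᵥ s.y l i) ⬝ᵥ (mi - s.m l i)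
    + (D.p i • s.x l i) ⬝ᵥ (li - s.lam l i)

/-- Right-hand side of the cut with index `l` for the negative penalty. -/
noncomputable def penaltyCut (R : (Fin I → Fin J → ℝ) → Set (Fin J → ℝ))
    (s : BundleIterates I J M N) (l : ℕ) (m : Fin I → Fin J → ℝ) : ℝ :=
  -(penalty R (s.m l)).toReal + ∑ i, s.rho l i ⬝ᵥ (m i - s.m l i)

/-- Objective of the master problem with proximal parameter `r` and centers `mc`, `lc`. The
squared Euclidean norm of a vector `a` is `a ⬝ᵥ a`. -/
def masterObjective (v : Fin J → ℝ) (r : ℝ) (mc : Fin I → Fin J → ℝ) (lc : Fin I → Fin M → ℝ)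
    (z : MasterPoint I J M) : ℝ :=
  ∑ i, z.vartheta i + z.eta - ∑ i, z.m i ⬝ᵥ v
    - ∑ i, r * ((z.m i - mc i) ⬝ᵥ (z.m i - mc i))
    - ∑ i, r * ((z.lam i - lc i) ⬝ᵥ (z.lam i - lc i))

/-- Constraints of the master problem with the cuts `1, …, k`. -/
def IsMasterFeasible (R : (Fin I → Fin J → ℝ) → Set (Fin J → ℝ)) (s : BundleIterates I J M N)
    (k : ℕ) (z : MasterPoint I J M) : Prop :=
  (∀ i, ∀ l ∈ Finset.Icc 1 k, z.vartheta i ≤ D.scenarioCut s l i (z.m i) (z.lam i)) ∧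
  (∀ l ∈ Finset.Icc 1 k, z.eta ≤ penaltyCut R s l z.m) ∧
  D.IsDualFeasible z.m z.lam

/-- Optimal solutions of the master problem with the cuts `1, …, k` and the centers of
iteration `k`. -/
def IsMasterOptimal (R : (Fin I → Fin J → ℝ) → Set (Fin J → ℝ)) (v : Fin J → ℝ) (r : ℝ)
    (s : BundleIterates I J M N) (k : ℕ) (z : MasterPoint I J M) : Prop :=
  D.IsMasterFeasible R s k z ∧
    ∀ z', D.IsMasterFeasible R s k z' →
      masterObjective v r (s.mbar k) (s.lambar k) z'
        ≤ masterObjective v r (s.mbar k) (s.lambar k) z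

/-- Objective value of the dual problem at the iterate `k`. -/
noncomputable def iterValue (R : (Fin I → Fin J → ℝ) → Set (Fin J → ℝ)) (v : Fin J → ℝ)
    (s : BundleIterates I J M N) (k : ℕ) : ℝ :=
  D.dualObjective R v (s.m k) (s.lam k)

/-- Objective value of the dual problem at the centers in force when iteration `k` begins, that
is, at the centers of iteration `k - 1` (used only for `k ≥ 2`). -/
noncomputable def centerValue (R : (Fin I → Fin J → ℝ) → Set (Fin J → ℝ)) (v : Fin J → ℝ)
    (s : BundleIterates I J M N) (k : ℕ) : ℝ :=
  D.dualObjective R v (s.mbar (k - 1)) (s.lambar (k - 1))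

/-- Value of the cutting-plane model at the iterate `k` (used only for `k ≥ 2`). -/
def modelValue (v : Fin J → ℝ) (s : BundleIterates I J M N) (k : ℕ) : ℝ :=
  ∑ i, s.vartheta k i + s.eta k - ∑ i, s.m k i ⬝ᵥ v

/-- Iteration `k` is a descent iteration: its iterate becomes the new center. -/
def IsDescent (R : (Fin I → Fin J → ℝ) → Set (Fin J → ℝ)) (v : Fin J → ℝ) (γ : ℝ)
    (s : BundleIterates I J M N) (k : ℕ) : Prop :=
  k = 1 ∨ (2 ≤ k ∧
    (1 - γ) * D.centerValue R v s k + γ * modelValue v s k ≤ D.iterValue R v s k)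

/-- `s` follows the dual bundle method, started at `(m₁, lam₁)`, up to and including the center
update of iteration `H`. -/
structure IsBundleRun (R : (Fin I → Fin J → ℝ) → Set (Fin J → ℝ)) (v : Fin J → ℝ) (r γ : ℝ)
    (m₁ : Fin I → Fin J → ℝ) (lam₁ : Fin I → Fin M → ℝ) (s : BundleIterates I J M N) (H : ℕ) :
    Prop where
  start : s.m 1 = m₁ ∧ s.lam 1 = lam₁
  start_feasible : D.IsDualFeasible m₁ lam₁
  subproblem : ∀ k, 1 ≤ k → k ≤ H → ∀ i, (s.x k i, s.y k i) ∈ D.scenarioSet i ∧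
    IsMinOn (D.subObjective i (s.m k i) (s.lam k i)) (D.scenarioSet i) (s.x k i, s.y k i)
  subgradient : ∀ k, 1 ≤ k → k ≤ H → IsPenaltySubgradient R (s.m k) (s.rho k)
  descent_step : ∀ k, 1 ≤ k → k ≤ H → D.IsDescent R v γ s k →
    s.mbar k = s.m k ∧ s.lambar k = s.lam k
  null_step : ∀ k, 1 ≤ k → k ≤ H → ¬ D.IsDescent R v γ s k →
    s.mbar k = s.mbar (k - 1) ∧ s.lambar k = s.lambar (k - 1)
  master : ∀ k, 1 ≤ k → k < H → D.IsMasterOptimal R v r s k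
    ⟨s.m (k + 1), s.lam (k + 1), s.vartheta (k + 1), s.eta (k + 1)⟩

/-- The approximate stopping condition with tolerance `ε`, tested at the end of iteration `k`. -/
def StopCondition (R : (Fin I → Fin J → ℝ) → Set (Fin J → ℝ)) (v : Fin J → ℝ) (ε : ℝ)
    (s : BundleIterates I J M N) (k : ℕ) : Prop :=
  modelValue v s (k + 1) - D.centerValue R v s (k + 1) ≤ ε

/-- `k` is the iteration at which the method with tolerance `ε` stops. -/
def IsStoppingIteration (R : (Fin I → Fin J → ℝ) → Set (Fin J → ℝ)) (v : Fin J → ℝ) (ε : ℝ)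
    (s : BundleIterates I J M N) (k : ℕ) : Prop :=
  1 ≤ k ∧ D.StopCondition R v ε s k ∧ ∀ l, 1 ≤ l → l < k → ¬ D.StopCondition R v ε s l

/-- `n + 1` is the first descent iteration after iteration `k`. -/
def IsNextDescent (R : (Fin I → Fin J → ℝ) → Set (Fin J → ℝ)) (v : Fin J → ℝ) (γ : ℝ)
    (s : BundleIterates I J M N) (k n : ℕ) : Prop :=
  k ≤ n ∧ D.IsDescent R v γ s (n + 1) ∧ ∀ l, k < l → l ≤ n → ¬ D.IsDescent R v γ s l

/-- Lagrangian of the master problem with the cuts `1, …, n` and centers `mc`, `lc`. -/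
noncomputable def masterLagrangian (R : (Fin I → Fin J → ℝ) → Set (Fin J → ℝ)) (v : Fin J → ℝ)
    (r : ℝ) (s : BundleIterates I J M N) (mc : Fin I → Fin J → ℝ) (lc : Fin I → Fin M → ℝ)
    (n : ℕ) (z : MasterPoint I J M) (d : MasterMultipliers I J M) : ℝ :=
  masterObjective v r mc lc z
    + ∑ i, ∑ l ∈ Finset.Icc 1 n,
        d.tau i l * (D.scenarioCut s l i (z.m i) (z.lam i) - z.vartheta i)
    + ∑ l ∈ Finset.Icc 1 n, d.theta l * (penaltyCut R s l z.m - z.eta)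
    - d.sigma ⬝ᵥ (∑ i, D.p i • z.lam i)
    + d.psi * (1 - ∑ i, ∑ j, z.m i j)
    + ∑ i, d.nu i ⬝ᵥ z.m i

/-- Objective of the Lagrangian dual of the master problem. -/
noncomputable def masterDualObjective (R : (Fin I → Fin J → ℝ) → Set (Fin J → ℝ))
    (v : Fin J → ℝ) (r : ℝ) (s : BundleIterates I J M N) (mc : Fin I → Fin J → ℝ)
    (lc : Fin I → Fin M → ℝ) (n : ℕ) (d : MasterMultipliers I J M) : EReal :=
  ⨆ z : MasterPoint I J M, ((D.masterLagrangian R v r s mc lc n z d : ℝ) : EReal)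

/-- Sign constraints of the Lagrangian dual of the master problem with the cuts `1, …, n`. -/
def IsMasterDualFeasible (n : ℕ) (d : MasterMultipliers I J M) : Prop :=
  (∀ i, ∀ l ∈ Finset.Icc 1 n, 0 ≤ d.tau i l) ∧ (∀ l ∈ Finset.Icc 1 n, 0 ≤ d.theta l) ∧ 0 ≤ d.nu

/-- Optimal solutions of the Lagrangian dual of the master problem. -/
def IsMasterDualOptimal (R : (Fin I → Fin J → ℝ) → Set (Fin J → ℝ)) (v : Fin J → ℝ) (r : ℝ)
    (s : BundleIterates I J M N) (mc : Fin I → Fin J → ℝ) (lc : Fin I → Fin M → ℝ) (n : ℕ)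
    (d : MasterMultipliers I J M) : Prop :=
  IsMasterDualFeasible n d ∧ ∀ d', IsMasterDualFeasible n d' →
    D.masterDualObjective R v r s mc lc n d ≤ D.masterDualObjective R v r s mc lc n d'

/-- The situation in which a primal solution is recovered: the bundle method with tolerance `ε`
stops at iteration `k`, the iterations are continued up to the next descent iteration `n + 1`, and
`d` is a dual optimal solution of the master problem with the centers of iteration `k` and the
cuts `1, …, n`. -/
structure IsRecovery (R : (Fin I → Fin J → ℝ) → Set (Fin J → ℝ)) (v : Fin J → ℝ) (r γ : ℝ)
    (m₁ : Fin I → Fin J → ℝ) (lam₁ : Fin I → Fin M → ℝ) (ε : ℝ) (s : BundleIterates I J M N)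
    (k n : ℕ) (d : MasterMultipliers I J M) : Prop where
  run : D.IsBundleRun R v r γ m₁ lam₁ s (n + 1)
  stopping : D.IsStoppingIteration R v ε s k
  next : D.IsNextDescent R v γ s k n
  dual : D.IsMasterDualOptimal R v r s (s.mbar k) (s.lambar k) n d

end StochProgram

/-- The recovered first-stage decision, scenario by scenario. -/
def recoveredX {I J M N : ℕ} (s : BundleIterates I J M N) (n : ℕ) (d : MasterMultipliers I J M) :
    Fin I → Fin M → ℝ :=
  fun i => ∑ l ∈ Finset.Icc 1 n, d.tau i l • s.x l i

/-- The recovered second-stage decision, scenario by scenario. -/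
def recoveredY {I J M N : ℕ} (s : BundleIterates I J M N) (n : ℕ) (d : MasterMultipliers I J M) :
    Fin I → Fin N → ℝ :=
  fun i => ∑ l ∈ Finset.Icc 1 n, d.tau i l • s.y l i

/-- The recovered step length: the infimum of the step lengths from `v` along `1` into
`R (C x + Q y)` at the recovered decisions. -/
noncomputable def recoveredAlpha {I J K L M N : ℕ} (D : StochProgram I J K L M N)
    (R : (Fin I → Fin J → ℝ) → Set (Fin J → ℝ)) (v : Fin J → ℝ)
    (s : BundleIterates I J M N) (n : ℕ) (d : MasterMultipliers I J M) : ℝ :=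
  sInf (D.steps R v (recoveredX s n d) (recoveredY s n d))

/-! Write P for the optimal value, ϱ for `r`, and Δ = (Δm, Δλ) for the step from the center to the
master solution (m, λ) at iteration n + 1. No strong duality or attainment is needed for the dual
problem itself: weak duality and duality for the finite master problem suffice.

The penalty is the support function of the closed convex acceptance set, so negated subgradients are
acceptable (`neg_mem_acceptanceSet`) and every cut is linear without constant term. The master
problem is a concave quadratic program with affine constraints. Farkas' lemma closes its duality
gap, so any dual optimal multipliers satisfy (`IsMasterDualOptimal.isKKT`): τ_i and θ sum to 1, cost
+ Σ θρ - ψ + ν = v + 2ϱΔm, and p_i (x_i - σ) = 2ϱΔλ_i. Convex weights give scenario feasibility,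
closedness of the acceptance set gives attainment, and ϱ‖Δ‖² ≤ ε (`modelValue_le_of_stopCondition`)
gives x_i - σ → 0.

Upper bound on the step length: stationarity in m makes ψ + 2ϱ‖Δm‖ an admissible step, while the
model value equals ψ + 2ϱ⟨Δm, m⟩ + 2ϱ⟨Δλ, λ⟩ and is at most F(center) + 2ε ≤ P + 2ε. The delicate
term is ⟨Δλ, λ⟩, because λ need not stay bounded as ε → 0. The centers are therefore compared with a
fixed η-optimal dual point. Each descent step before stopping raises F by more than γε, so the
errors η telescope and the squared distance is O(1) + O(η/ε) (`dualDist_center_le`). Multiplied by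
‖Δ‖² ≤ ε/ϱ, this is O(ε) + O(η); choosing η first and ε afterwards makes it small.

Lower bound: the recovered decisions are scenario-wise feasible with nearly equal first stages. Such
decisions form compact sets even if single scenario sets are unbounded, and a nested intersection
argument (`exists_refValue_sub_lt`) excludes values below P - δ. -/

/-- The standard inner product of two families of vectors. -/
def pairing {ι κ : Type*} [Fintype ι] [Fintype κ] (u w : ι → κ → ℝ) : ℝ := ∑ i, u i ⬝ᵥ w i

/-! ### Bilinearity and Euclidean estimates for the pairing. -/

section Pairing

variable {ι κ : Type*} [Fintype ι] [Fintype κ] (u u' w : ι → κ → ℝ)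

theorem pairing_comm : pairing u w = pairing w u := by
  simp only [pairing, dotProduct_comm]

theorem pairing_add_left : pairing (u + u') w = pairing u w + pairing u' w := by
  simp [pairing, add_dotProduct, Finset.sum_add_distrib]

theorem pairing_smul_left (c : ℝ) : pairing (c • u) w = c * pairing u w := by
  simp [pairing, smul_dotProduct, Finset.mul_sum]

theorem pairing_neg_left : pairing (-u) w = -pairing u w := by
  simp [pairing]

theorem pairing_sub_left : pairing (u - u') w = pairing u w - pairing u' w := by
  rw [sub_eq_add_neg, pairing_add_left, pairing_neg_left, sub_eq_add_neg]

theorem pairing_add_right : pairing w (u + u') = pairing w u + pairing w u' := by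
  simp only [pairing_comm w, pairing_add_left]

theorem pairing_smul_right (c : ℝ) : pairing w (c • u) = c * pairing w u := by
  simp only [pairing_comm w, pairing_smul_left]

theorem pairing_neg_right : pairing w (-u) = -pairing w u := by
  simp only [pairing_comm w, pairing_neg_left]

theorem pairing_sub_right : pairing w (u - u') = pairing w u - pairing w u' := by
  simp only [pairing_comm w, pairing_sub_left]

@[simp] theorem pairing_zero_left : pairing 0 w = 0 := by
  simp [pairing]

theorem pairing_sum_left {β : Type*} (s : Finset β) (f : β → ι → κ → ℝ) :
    pairing (∑ l ∈ s, f l) w = ∑ l ∈ s, pairing (f l) w := by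
  classical
  induction s using Finset.induction_on with
  | empty => simp
  | insert a s ha ih => rw [Finset.sum_insert ha, Finset.sum_insert ha, pairing_add_left, ih]

variable {u u' w}

theorem pairing_nonneg (hu : 0 ≤ u) (hw : 0 ≤ w) : 0 ≤ pairing u w :=
  Finset.sum_nonneg fun i _ => Finset.sum_nonneg fun j _ => mul_nonneg (hu i j) (hw i j)

variable (u w)

theorem sq_le_pairing_self (i : ι) (j : κ) : u i j ^ 2 ≤ pairing u u := by
  calc u i j ^ 2 = u i j * u i j := sq _
    _ ≤ u i ⬝ᵥ u i := Finset.single_le_sum (f := fun j => u i j * u i j)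
        (fun j _ => mul_self_nonneg _) (Finset.mem_univ j)
    _ ≤ pairing u u := Finset.single_le_sum (f := fun i => u i ⬝ᵥ u i)
        (fun i _ => Finset.sum_nonneg fun j _ => mul_self_nonneg _) (Finset.mem_univ i)

theorem pairing_self_nonneg : 0 ≤ pairing u u :=
  Finset.sum_nonneg fun _ _ => Finset.sum_nonneg fun _ _ => mul_self_nonneg _

variable {u} in
theorem eq_zero_of_pairing_self_eq_zero (h : pairing u u = 0) : u = 0 := by
  funext i j
  have h2 : u i j ^ 2 = 0 := le_antisymm (h ▸ sq_le_pairing_self u i j) (sq_nonneg _)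
  simpa using h2

theorem abs_pairing_le :
    |pairing u w| ≤ √(pairing u u) * √(pairing w w) := by
  have h (u w : ι → κ → ℝ) : pairing u w = ∑ x : ι × κ, u x.1 x.2 * w x.1 x.2 := by
    rw [Fintype.sum_prod_type]; rfl
  rw [← Real.sqrt_mul (pairing_self_nonneg u)]
  refine Real.abs_le_sqrt ?_
  rw [h, h, h]
  simpa only [sq] using Finset.sum_mul_sq_le_sq_mul_sq Finset.univ
    (fun x : ι × κ => u x.1 x.2) (fun x : ι × κ => w x.1 x.2)

theorem abs_le_sqrt_pairing_self (i : ι) (j : κ) : |u i j| ≤ √(pairing u u) :=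
  Real.abs_le_sqrt (sq_le_pairing_self u i j)

end Pairing

/-- A quadratic `a t - q t²` which is nonpositive for small `t > 0` has nonpositive slope. -/
theorem nonpos_of_forall_mul_le_sq {a q : ℝ}
    (h : ∀ t : ℝ, 0 < t → t ≤ 1 → t * a ≤ t ^ 2 * q) : a ≤ 0 := by
  by_contra! ha
  have hq : a ≤ q := by simpa using h 1 one_pos le_rfl
  have hq0 : 0 < q := ha.trans_le hq
  -- This `t` maximizes `t * a - t ^ 2 * q`; the case `t = 1` gave `a ≤ q`, so it is admissible.
  have h1 := h (a / (2 * q)) (by positivity) (by rw [div_le_one (by positivity)]; linarith)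
  have h2 : a / (2 * q) * a - (a / (2 * q)) ^ 2 * q = a ^ 2 / (4 * q) := by
    field_simp; ring
  have : 0 < a ^ 2 / (4 * q) := by positivity
  linarith

/-! ### Farkas' lemma and linear programming multipliers. -/

section Farkas

variable {E : Type*} [AddCommGroup E] [Module ℝ E]

/-- **Farkas' lemma** for finitely many linear functionals. -/
theorem farkas {ι : Type*} (s : Finset ι) (a : ι → E →ₗ[ℝ] ℝ) (c : E →ₗ[ℝ] ℝ)
    (h : ∀ x, (∀ j ∈ s, a j x ≤ 0) → c x ≤ 0) :
    ∃ μ : ι → ℝ, (∀ j, 0 ≤ μ j) ∧ c = ∑ j ∈ s, μ j • a j := by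
  classical
  induction s using Finset.induction_on generalizing a c with
  | empty =>
    refine ⟨0, fun _ => le_rfl, ?_⟩
    ext x
    have h1 := h x (by simp)
    have h2 := h (-x) (by simp)
    rw [map_neg] at h2
    simpa using le_antisymm h1 (by linarith)
  | insert k s hk ih =>
    by_cases hs : ∀ x, (∀ j ∈ s, a j x ≤ 0) → c x ≤ 0
    · obtain ⟨μ, hμ, hc⟩ := ih a c hs
      refine ⟨fun j => if j = k then 0 else μ j, fun j => by dsimp; split_ifs <;> simp [hμ], ?_⟩
      rw [Finset.sum_insert hk, hc]
      simp only [if_true, zero_smul, zero_add]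
      exact Finset.sum_congr rfl fun j hj => by rw [if_neg (ne_of_mem_of_not_mem hj hk)]
    -- The functional `a k` is indispensable: some `y` satisfies all other constraints with `c y >
    -- 0`, which forces `a k y > 0`. Projecting along `y` onto the kernel of `a k` eliminates that
    -- constraint.
    · push Not at hs
      obtain ⟨y, hy, hcy⟩ := hs
      have hky : 0 < a k y := by
        by_contra! hky
        exact absurd (h y fun j hj => by
          rcases Finset.mem_insert.1 hj with rfl | hj
          · exact hky
          · exact hy j hj) hcy.not_ge
      obtain ⟨μ, hμ, hc⟩ := ih (fun j => a j - (a j y / a k y) • a k) (c - (c y / a k y) • a k) (by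
        intro x hx
        have := h (x - (a k x / a k y) • y) (by
          intro j hj
          rcases Finset.mem_insert.1 hj with rfl | hj
          · simp [hky.ne']
          · have := hx j hj
            simp only [LinearMap.sub_apply, LinearMap.smul_apply, smul_eq_mul, map_sub,
              map_smul] at this ⊢
            calc _ = _ := by ring
              _ ≤ 0 := this)
        simp only [LinearMap.sub_apply, LinearMap.smul_apply, smul_eq_mul, map_sub,
          map_smul] at this ⊢
        calc _ = _ := by ring
          _ ≤ 0 := this)
      -- The coefficient of `a k` is found by collecting terms, equivalently by evaluating at `y`;
      -- it is nonnegative because `c y > 0` and `a j y ≤ 0` on `s`.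
      refine ⟨fun j => if j = k then (c y - ∑ j ∈ s, μ j * a j y) / a k y else μ j, fun j => ?_, ?_⟩
      · dsimp
        split_ifs
        · refine div_nonneg ?_ hky.le
          have : ∑ j ∈ s, μ j * a j y ≤ 0 :=
            Finset.sum_nonpos fun j hj => mul_nonpos_of_nonneg_of_nonpos (hμ j) (hy j hj)
          linarith
        · exact hμ j
      · rw [Finset.sum_insert hk]
        simp only [if_true]
        have h1 : ∑ j ∈ s, (if j = k then (c y - ∑ j ∈ s, μ j * a j y) / a k y else μ j) • a j
            = ∑ j ∈ s, μ j • a j :=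
          Finset.sum_congr rfl fun j hj => by rw [if_neg (ne_of_mem_of_not_mem hj hk)]
        rw [h1]
        ext x
        have h2 := congrArg (fun f => f x) hc
        simp only [LinearMap.sub_apply, LinearMap.smul_apply, smul_eq_mul, LinearMap.add_apply,
          LinearMap.sum_apply, mul_sub, Finset.sum_sub_distrib] at h2 ⊢
        have h3 : ∑ j ∈ s, μ j * (a j y / a k y * a k x)
            = (∑ j ∈ s, μ j * a j y) / a k y * a k x := by
          rw [Finset.sum_div, Finset.sum_mul]
          exact Finset.sum_congr rfl fun j _ => by ring
        rw [h3] at h2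
        rw [sub_div, sub_mul]
        linarith

/-- Lagrange multipliers for a linear program with affine inequality constraints `0 ≤ a j z + b j`
and an optimal solution `z₀`. -/
theorem exists_multipliers_of_inequalities {ι : Type*} [Fintype ι] (a : ι → E →ₗ[ℝ] ℝ) (b : ι → ℝ)
    (g : E →ₗ[ℝ] ℝ) (z₀ : E) (hz₀ : ∀ j, 0 ≤ a j z₀ + b j)
    (h : ∀ z, (∀ j, 0 ≤ a j z + b j) → g z ≤ g z₀) :
    ∃ μ : ι → ℝ, (∀ j, 0 ≤ μ j) ∧ ∀ z, g z + ∑ j, μ j * (a j z + b j) ≤ g z₀ := by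
  -- Homogenization: the extra coordinate `s ≥ 0` scales the constants `b j`. Points with `s > 0`
  -- rescale to feasible points, and those with `s = 0` are recession directions, which can be added
  -- to `z₀`.
  let A : Option ι → E × ℝ →ₗ[ℝ] ℝ := fun o => o.elim (-LinearMap.snd ℝ E ℝ)
    fun j => -((a j).comp (LinearMap.fst ℝ E ℝ) + b j • LinearMap.snd ℝ E ℝ)
  obtain ⟨μ, hμ, hc⟩ := farkas Finset.univ A
    (g.comp (LinearMap.fst ℝ E ℝ) - g z₀ • LinearMap.snd ℝ E ℝ) (by
      rintro ⟨z, s⟩ hx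
      have hs : 0 ≤ s := by simpa [A] using hx none (Finset.mem_univ _)
      have ha : ∀ j, 0 ≤ a j z + b j * s := fun j => by
        have : -(a j z + b j * s) ≤ 0 := hx (some j) (Finset.mem_univ _)
        linarith
      suffices g z ≤ g z₀ * s by simpa using this
      rcases hs.eq_or_lt with rfl | hs
      · have := h (z₀ + z) fun j => by
          have := ha j
          have := hz₀ j
          rw [map_add]; linarith
        rw [map_add] at this
        linarith
      · have := h (s⁻¹ • z) fun j => by
          have h1 : a j (s⁻¹ • z) + b j = s⁻¹ * (a j z + b j * s) := by
            rw [map_smul, smul_eq_mul]; field_simp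
          rw [h1]
          exact mul_nonneg (inv_nonneg.2 hs.le) (ha j)
        rw [map_smul, smul_eq_mul, inv_mul_le_iff₀ hs] at this
        linarith)
  -- Dropping the nonnegative multiplier of `s ≥ 0` turns Farkas' identity at `s = 1` into an
  -- inequality.
  refine ⟨fun j => μ (some j), fun j => hμ _, fun z => ?_⟩
  have h1 := congrArg (fun f => f (z, (1 : ℝ))) hc
  simp only [LinearMap.sub_apply, LinearMap.comp_apply, LinearMap.smul_apply, LinearMap.fst_apply,
    LinearMap.snd_apply, Fintype.sum_option, LinearMap.add_apply, LinearMap.sum_apply, A,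
    LinearMap.neg_apply, Option.elim, smul_eq_mul, mul_one, mul_neg, Finset.sum_neg_distrib] at h1
  have := hμ none
  linarith

/-- Lagrange multipliers for a linear program with affine inequality constraints `0 ≤ a j z + b j`,
affine equality constraints `a' j z + b' j = 0` and an optimal solution `z₀`. -/
theorem exists_multipliers {ι κ : Type*} [Fintype ι] [Fintype κ]
    (a : ι → E →ₗ[ℝ] ℝ) (b : ι → ℝ) (a' : κ → E →ₗ[ℝ] ℝ) (b' : κ → ℝ)
    (g : E →ₗ[ℝ] ℝ) (z₀ : E) (hz₀ : ∀ j, 0 ≤ a j z₀ + b j) (hz₀' : ∀ j, a' j z₀ + b' j = 0)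
    (h : ∀ z, (∀ j, 0 ≤ a j z + b j) → (∀ j, a' j z + b' j = 0) → g z ≤ g z₀) :
    ∃ (μ : ι → ℝ) (μ' : κ → ℝ), (∀ j, 0 ≤ μ j) ∧
      ∀ z, g z + ∑ j, μ j * (a j z + b j) + ∑ j, μ' j * (a' j z + b' j) ≤ g z₀ := by
  obtain ⟨μ, hμ, H⟩ := exists_multipliers_of_inequalities
    (Sum.elim a (Sum.elim a' fun j => -a' j)) (Sum.elim b (Sum.elim b' fun j => -b' j)) g z₀
    (by
      rintro (j | j | j)
      · exact hz₀ j
      · exact (hz₀' j).ge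
      · have := hz₀' j
        simp only [Sum.elim_inr, LinearMap.neg_apply]; linarith)
    (fun z hz => h z (fun j => hz (Sum.inl j)) fun j => le_antisymm
      (by have := hz (Sum.inr (Sum.inr j))
          simp only [Sum.elim_inr, LinearMap.neg_apply] at this; linarith)
      (hz (Sum.inr (Sum.inl j))))
  refine ⟨fun j => μ (Sum.inl j), fun j => μ (Sum.inr (Sum.inl j)) - μ (Sum.inr (Sum.inr j)),
    fun j => hμ _, fun z => ?_⟩
  have := H z
  simp only [Fintype.sum_sum_type, Sum.elim_inl, Sum.elim_inr, LinearMap.neg_apply] at this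
  simp only [sub_mul, Finset.sum_sub_distrib]
  have h1 : ∑ j, μ (Sum.inr (Sum.inr j)) * (-a' j z + -b' j)
      = -∑ j, μ (Sum.inr (Sum.inr j)) * (a' j z + b' j) := by
    rw [← Finset.sum_neg_distrib]
    exact Finset.sum_congr rfl fun j _ => by ring
  linarith

end Farkas
-- Acceptance set, penalty and subgradients of the penalty.
namespace IsMultivariateConvexRiskMeasure

variable {I J : ℕ} {R : (Fin I → Fin J → ℝ) → Set (Fin J → ℝ)}

theorem mem_iff_sub_mem (hR : IsMultivariateConvexRiskMeasure R) (u : Fin I → Fin J → ℝ)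
    (a : Fin J → ℝ) : a ∈ R u ↔ (fun i => u i - a) ∈ acceptanceSet R := by
  have h : u = fun i => (u i - a) + a := by ext; simp
  conv_lhs => rw [h, hR.translative]
  simp [acceptanceSet]

theorem isLowerSet_acceptanceSet (hR : IsMultivariateConvexRiskMeasure R) :
    IsLowerSet (acceptanceSet R) :=
  fun u u' h hu => hR.monotone u' u h hu

theorem convex_acceptanceSet (hR : IsMultivariateConvexRiskMeasure R) :
    Convex ℝ (acceptanceSet R) := by
  refine convex_iff_forall_pos.2 fun u hu u' hu' c c' hc hc' hcc => ?_
  obtain rfl : c' = 1 - c := by linarith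
  simpa [acceptanceSet] using hR.convex u u' c hc (by linarith) 0 hu 0 hu'

theorem nonempty_acceptanceSet (hR : IsMultivariateConvexRiskMeasure R) :
    (acceptanceSet R).Nonempty := by
  obtain ⟨a, ha⟩ := Set.nonempty_iff_ne_empty.2 (hR.finite 0).1
  exact ⟨_, (hR.mem_iff_sub_mem 0 a).1 ha⟩

theorem mem_of_le (hR : IsMultivariateConvexRiskMeasure R) {u : Fin I → Fin J → ℝ}
    {a a' : Fin J → ℝ} (ha : a ∈ R u) (h : a ≤ a') : a' ∈ R u := by
  rw [hR.mem_iff_sub_mem] at ha ⊢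
  exact hR.isLowerSet_acceptanceSet (fun i => sub_le_sub_left h _) ha

theorem le_penalty {m u : Fin I → Fin J → ℝ} (hu : u ∈ acceptanceSet R) :
    ((pairing m u : ℝ) : EReal) ≤ penalty R m :=
  le_iSup₂ (f := fun u (_ : u ∈ acceptanceSet R) => ((∑ i, m i ⬝ᵥ u i : ℝ) : EReal)) u hu

theorem penalty_le {m : Fin I → Fin J → ℝ} {c : ℝ}
    (h : ∀ u ∈ acceptanceSet R, pairing m u ≤ c) : penalty R m ≤ c :=
  iSup₂_le fun u hu => EReal.coe_le_coe_iff.2 (h u hu)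

theorem penalty_ne_bot (hR : IsMultivariateConvexRiskMeasure R) (m : Fin I → Fin J → ℝ) :
    penalty R m ≠ ⊥ := by
  obtain ⟨u, hu⟩ := hR.nonempty_acceptanceSet
  exact ((EReal.bot_lt_coe _).trans_le (le_penalty hu)).ne'

theorem coe_toReal_penalty (hR : IsMultivariateConvexRiskMeasure R) {m : Fin I → Fin J → ℝ}
    (h : penalty R m ≠ ⊤) : ((penalty R m).toReal : EReal) = penalty R m :=
  EReal.coe_toReal h (hR.penalty_ne_bot m)

theorem pairing_le_toReal_penalty (hR : IsMultivariateConvexRiskMeasure R)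
    {m u : Fin I → Fin J → ℝ} (h : penalty R m ≠ ⊤) (hu : u ∈ acceptanceSet R) :
    pairing m u ≤ (penalty R m).toReal := by
  rw [← EReal.coe_le_coe_iff, hR.coe_toReal_penalty h]
  exact le_penalty hu

/-- Real form of the subgradient inequality. -/
theorem toReal_penalty_le_of_subgradient (hR : IsMultivariateConvexRiskMeasure R)
    {m' g m : Fin I → Fin J → ℝ} (h : IsPenaltySubgradient R m' g) (hm : 0 ≤ m) {c : ℝ}
    (hc : penalty R m ≤ c) : (penalty R m').toReal - pairing g (m - m') ≤ c := by
  have h1 := h.2 m hm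
  have h2 : penalty R m ≠ ⊤ := (hc.trans_lt (EReal.coe_lt_top c)).ne
  rw [← hR.coe_toReal_penalty h.1, ← hR.coe_toReal_penalty h2] at h1
  rw [← hR.coe_toReal_penalty h2] at hc
  have h3 : -(penalty R m).toReal ≤ -(penalty R m').toReal + pairing g (m - m') := by
    rw [← EReal.coe_le_coe_iff]; exact_mod_cast h1
  have h4 := EReal.coe_le_coe_iff.1 hc
  linarith

/-- Every linear functional is a pairing. -/
theorem exists_pairing (φ : (Fin I → Fin J → ℝ) →ₗ[ℝ] ℝ) :
    ∃ w : Fin I → Fin J → ℝ, ∀ u, φ u = pairing w u := by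
  refine ⟨fun i j => φ (Pi.single i (Pi.single j 1)), fun u => ?_⟩
  have h : u = ∑ i, ∑ j, u i j • Pi.single i (Pi.single j (1 : ℝ)) := by
    ext a b
    simp only [Finset.sum_apply, Pi.smul_apply, smul_eq_mul]
    rw [Finset.sum_eq_single a, Finset.sum_eq_single b] <;> simp +contextual [Pi.single_apply]
  conv_lhs => rw [h]
  simp [pairing, dotProduct, mul_comm]

/-- Negatives of subgradients of the negative penalty are acceptable. -/
theorem neg_mem_acceptanceSet (hR : IsMultivariateConvexRiskMeasure R)
    {m' g : Fin I → Fin J → ℝ} (h : IsPenaltySubgradient R m' g) (hm' : 0 ≤ m') :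
    -g ∈ acceptanceSet R := by
  by_contra hg
  obtain ⟨φ, c, h1, h2⟩ :=
    geometric_hahn_banach_closed_point hR.convex_acceptanceSet hR.closed hg
  obtain ⟨w, hw⟩ := exists_pairing φ.toLinearMap
  have h1' : ∀ u ∈ acceptanceSet R, pairing w u < c := fun u hu => (hw u) ▸ h1 u hu
  have h2' : c < pairing w (-g) := (hw (-g)) ▸ h2
  -- The acceptance set is a lower set, so a negative coordinate of `w` would make the pairing with
  -- `w` unbounded above on it.
  have hw0 : 0 ≤ w := by
    obtain ⟨u, hu⟩ := hR.nonempty_acceptanceSet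
    intro i j
    by_contra! hneg
    change w i j < 0 at hneg
    let e : Fin I → Fin J → ℝ := Pi.single i (Pi.single j 1)
    have he : pairing w e = w i j := by
      simp only [pairing, e]
      rw [Finset.sum_eq_single i] <;> simp +contextual
    have he0 : 0 ≤ e := Pi.single_nonneg.2 (Pi.single_nonneg.2 zero_le_one)
    let t : ℝ := |c - pairing w u| / (-w i j)
    have ht : 0 ≤ t := div_nonneg (abs_nonneg _) (by linarith)
    have := h1' (u - t • e) (hR.isLowerSet_acceptanceSet
      (sub_le_self _ (smul_nonneg ht he0)) hu)
    rw [pairing_sub_right, pairing_smul_right, he] at this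
    have h3 : t * w i j = -|c - pairing w u| := by
      simp only [t]; field_simp [hneg.ne]
    have := le_abs_self (c - pairing w u)
    linarith
  -- Since `w ≥ 0`, the subgradient inequality may be tested at `m' + w`. Subadditivity of the
  -- support function then contradicts the separation.
  have h3 : penalty R (m' + w) ≤ (((penalty R m').toReal + c : ℝ) : EReal) :=
    penalty_le fun u hu => by
      rw [pairing_add_left]
      exact add_le_add (hR.pairing_le_toReal_penalty h.1 hu) (h1' u hu).le
  have h4 := hR.toReal_penalty_le_of_subgradient h (add_nonneg hm' hw0) h3
  rw [add_sub_cancel_left, pairing_comm] at h4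
  rw [pairing_neg_right] at h2'
  linarith

/-- Euler's identity for a positively homogeneous function: acceptability of `-g` gives one
inequality, the subgradient inequality at `0` the other. -/
theorem toReal_penalty_eq (hR : IsMultivariateConvexRiskMeasure R)
    {m' g : Fin I → Fin J → ℝ} (h : IsPenaltySubgradient R m' g) (hm' : 0 ≤ m') :
    (penalty R m').toReal = -pairing g m' := by
  have h1 := hR.pairing_le_toReal_penalty h.1 (hR.neg_mem_acceptanceSet h hm')
  have h2 := hR.toReal_penalty_le_of_subgradient h (le_refl 0) (c := 0)
    (penalty_le fun u _ => by simp)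
  rw [zero_sub, pairing_neg_right] at h2
  rw [pairing_neg_right, pairing_comm] at h1
  linarith

theorem penaltyCut_eq {M N : ℕ} (hR : IsMultivariateConvexRiskMeasure R)
    {s : BundleIterates I J M N} {l : ℕ} (h : IsPenaltySubgradient R (s.m l) (s.rho l))
    (hm : 0 ≤ s.m l) (m : Fin I → Fin J → ℝ) : StochProgram.penaltyCut R s l m = pairing (s.rho l) m := by
  have : StochProgram.penaltyCut R s l m
    = -(penalty R (s.m l)).toReal + pairing (s.rho l) (m - s.m l) := rfl
  rw [this, hR.toReal_penalty_eq h hm, pairing_sub_right]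
  ring

end IsMultivariateConvexRiskMeasure

/-! ### Attained step lengths and finiteness of the scalarization. -/

namespace StochProgram

variable {I J K L M N : ℕ} {D : StochProgram I J K L M N}
  {R : (Fin I → Fin J → ℝ) → Set (Fin J → ℝ)} {v : Fin J → ℝ}

theorem mem_steps_of_le (hR : IsMultivariateConvexRiskMeasure R) {x : Fin I → Fin M → ℝ}
    {y : Fin I → Fin N → ℝ} {α α' : ℝ} (h : α ∈ D.steps R v x y) (hα : α ≤ α') :
    α' ∈ D.steps R v x y :=
  hR.mem_of_le h fun j => by simpa using hα

theorem steps_nonempty (hR : IsMultivariateConvexRiskMeasure R) (x : Fin I → Fin M → ℝ)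
    (y : Fin I → Fin N → ℝ) : (D.steps R v x y).Nonempty := by
  obtain ⟨a, ha⟩ := Set.nonempty_iff_ne_empty.2 (hR.finite (D.cost x y)).1
  refine ⟨∑ j, |a j - v j|, hR.mem_of_le ha fun j => ?_⟩
  have h1 : |a j - v j| ≤ ∑ j, |a j - v j| :=
    Finset.single_le_sum (f := fun j => |a j - v j|) (fun _ _ => abs_nonneg _) (Finset.mem_univ j)
  have h2 := le_abs_self (a j - v j)
  dsimp only
  linarith

theorem steps_bddBelow (hR : IsMultivariateConvexRiskMeasure R) (x : Fin I → Fin M → ℝ)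
    (y : Fin I → Fin N → ℝ) : BddBelow (D.steps R v x y) := by
  by_contra h
  refine (hR.finite (D.cost x y)).2 (Set.eq_univ_of_forall fun a => ?_)
  -- Values of a risk measure are upward closed, so arbitrarily negative steps would put every point
  -- into the value.
  rw [not_bddBelow_iff] at h
  obtain ⟨α, hα, hlt⟩ := h (-∑ j, |a j - v j|)
  refine hR.mem_of_le hα fun j => ?_
  have h1 : |a j - v j| ≤ ∑ j, |a j - v j| :=
    Finset.single_le_sum (f := fun j => |a j - v j|) (fun _ _ => abs_nonneg _) (Finset.mem_univ j)
  have h2 := neg_abs_le (a j - v j)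
  linarith

theorem mem_steps_iff (hR : IsMultivariateConvexRiskMeasure R) {x : Fin I → Fin M → ℝ}
    {y : Fin I → Fin N → ℝ} {α : ℝ} :
    α ∈ D.steps R v x y ↔ (fun i j => D.cost x y i j - (v j + α)) ∈ acceptanceSet R :=
  hR.mem_iff_sub_mem _ _

theorem steps_isClosed (hR : IsMultivariateConvexRiskMeasure R) (x : Fin I → Fin M → ℝ)
    (y : Fin I → Fin N → ℝ) : IsClosed (D.steps R v x y) := by
  have : D.steps R v x y
    = (fun α : ℝ => fun i j => D.cost x y i j - (v j + α)) ⁻¹' acceptanceSet R :=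
    Set.ext fun α => mem_steps_iff hR
  rw [this]
  exact IsClosed.preimage (by fun_prop) hR.closed

theorem isLeast_sInf_steps (hR : IsMultivariateConvexRiskMeasure R) (x : Fin I → Fin M → ℝ)
    (y : Fin I → Fin N → ℝ) : IsLeast (D.steps R v x y) (sInf (D.steps R v x y)) :=
  (steps_isClosed hR x y).isLeast_csInf (steps_nonempty hR x y) (steps_bddBelow hR x y)

/-- The optimal value of the scalarization is a finite infimum. -/
theorem isGLB_refValue (hR : IsMultivariateConvexRiskMeasure R) (hX : D.feasibleSet.Nonempty)
    (hv : v ∉ D.upperImage R) : IsGLB (D.refValues R v) (D.refValue R v) := by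
  refine isGLB_csInf ?_ ⟨0, ?_⟩
  · obtain ⟨z, hz⟩ := hX
    obtain ⟨α, hα⟩ := steps_nonempty (D := D) (v := v) hR (fun _ => z.1) z.2
    exact ⟨α, z, hz, hα⟩
  · rintro α ⟨z, hz, hα⟩
    -- A negative step would place `v` itself in the upper image.
    by_contra! hneg
    refine hv (subset_closure (Set.mem_biUnion hz (hR.mem_of_le hα fun j => ?_)))
    dsimp only
    linarith

end StochProgram
-- Compactness and lower semicontinuity under relaxed nonanticipativity.
namespace StochProgram

variable {I J K L M N : ℕ} {D : StochProgram I J K L M N}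
  {R : (Fin I → Fin J → ℝ) → Set (Fin J → ℝ)} {v : Fin J → ℝ}

/-- Scenario-wise feasible decisions whose first-stage parts differ by at most `c`. -/
def nearlyFeasibleSet (D : StochProgram I J K L M N) (c : ℝ) :
    Set ((Fin I → Fin M → ℝ) × (Fin I → Fin N → ℝ)) :=
  {z | (∀ i, (z.1 i, z.2 i) ∈ D.scenarioSet i) ∧ ∀ i j, ‖z.1 i - z.1 j‖ ≤ c}

theorem isClosed_scenarioSet (i : Fin I) : IsClosed (D.scenarioSet i) :=
  (isClosed_le continuous_const continuous_fst).inter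
    ((isClosed_le continuous_const continuous_snd).inter
      ((isClosed_eq (by fun_prop) continuous_const).inter
        (isClosed_eq (by fun_prop) continuous_const)))

theorem isClosed_nearlyFeasibleSet (c : ℝ) : IsClosed (D.nearlyFeasibleSet c) := by
  have h : D.nearlyFeasibleSet c = (⋂ i, (fun z : (Fin I → Fin M → ℝ) × (Fin I → Fin N → ℝ) =>
      (z.1 i, z.2 i)) ⁻¹' D.scenarioSet i) ∩
      ⋂ i, ⋂ j, {z : (Fin I → Fin M → ℝ) × (Fin I → Fin N → ℝ) | ‖z.1 i - z.1 j‖ ≤ c} := by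
    ext z
    simp [nearlyFeasibleSet]
  rw [h]
  exact (isClosed_iInter fun i => (isClosed_scenarioSet i).preimage (by fun_prop)).inter
    (isClosed_iInter fun i => isClosed_iInter fun j => isClosed_le (by fun_prop) continuous_const)

/-- A bounded nonempty feasible set has no nonzero recession direction. -/
theorem eq_zero_of_recession (hX : Bornology.IsBounded D.feasibleSet)
    (hX_ne : D.feasibleSet.Nonempty) {d : (Fin M → ℝ) × (Fin I → Fin N → ℝ)}
    (h1 : 0 ≤ d.1) (h2 : 0 ≤ d.2) (hA : D.A *ᵥ d.1 = 0)
    (hT : ∀ i, D.T i *ᵥ d.1 + D.W i *ᵥ d.2 i = 0) : d = 0 := by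
  obtain ⟨z, hz⟩ := hX_ne
  obtain ⟨B, hB⟩ := hX.exists_norm_le
  have hmem : ∀ t : ℝ, 0 ≤ t → z + t • d ∈ D.feasibleSet := fun t ht => by
    refine ⟨add_nonneg hz.1 (smul_nonneg ht h1), add_nonneg hz.2.1 (smul_nonneg ht h2), ?_,
      fun i => ?_⟩
    · simp [Matrix.mulVec_add, Matrix.mulVec_smul, hA, hz.2.2.1]
    · have e1 := hz.2.2.2 i
      have e2 := hT i
      simp only [Prod.fst_add, Prod.snd_add, Prod.smul_fst, Prod.smul_snd, Pi.add_apply,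
        Pi.smul_apply, Matrix.mulVec_add, Matrix.mulVec_smul]
      rw [← e1, add_add_add_comm, ← smul_add, e2, smul_zero, add_zero]
  by_contra hd
  have hd' : 0 < ‖d‖ := norm_pos_iff.2 hd
  have hB0 : 0 ≤ B := (norm_nonneg _).trans (hB z hz)
  have h3 := hB _ (hmem ((2 * B + 1) / ‖d‖) (by positivity))
  have h4 := norm_sub_le (z + ((2 * B + 1) / ‖d‖) • d) z
  rw [add_sub_cancel_left, norm_smul, Real.norm_of_nonneg (by positivity),
    div_mul_cancel₀ _ hd'.ne'] at h4
  have := hB z hz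
  linarith

/-- An unbounded sequence, normalized, would converge to a nonzero recession direction whose first
stages coincide, since a gap of at most `c` vanishes after scaling. This would be a recession
direction of the bounded feasible set. The proof expresses this by minimizing the scale `1 / ‖z‖`
over a compact homogenized set. -/
theorem isCompact_nearlyFeasibleSet (hI : 0 < I) (hX : Bornology.IsBounded D.feasibleSet)
    (hX_ne : D.feasibleSet.Nonempty) (c : ℝ) : IsCompact (D.nearlyFeasibleSet c) := by
  refine Metric.isCompact_of_isClosed_isBounded (isClosed_nearlyFeasibleSet c) ?_
  let H : Set (((Fin I → Fin M → ℝ) × (Fin I → Fin N → ℝ)) × ℝ) :=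
    {w | (0 ≤ w.1.1 ∧ 0 ≤ w.1.2) ∧ ((∀ i, D.A *ᵥ w.1.1 i = w.2 • D.b) ∧
      (∀ i, D.T i *ᵥ w.1.1 i + D.W i *ᵥ w.1.2 i = w.2 • D.h i)) ∧
      ∀ i j, ‖w.1.1 i - w.1.1 j‖ ≤ w.2 * c}
  have hH : IsClosed H := by
    have h : H = ({w | 0 ≤ w.1.1} ∩ {w | 0 ≤ w.1.2}) ∩ (((⋂ i, {w | D.A *ᵥ w.1.1 i = w.2 • D.b}) ∩
        ⋂ i, {w | D.T i *ᵥ w.1.1 i + D.W i *ᵥ w.1.2 i = w.2 • D.h i}) ∩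
        ⋂ i, ⋂ j, {w | ‖w.1.1 i - w.1.1 j‖ ≤ w.2 * c}) := by
      ext w
      simp [H]
    rw [h]
    exact ((isClosed_le (by fun_prop) (by fun_prop)).inter
      (isClosed_le (by fun_prop) (by fun_prop))).inter
      (((isClosed_iInter fun i => isClosed_eq (by fun_prop) (by fun_prop)).inter
        (isClosed_iInter fun i => isClosed_eq (by fun_prop) (by fun_prop))).inter
        (isClosed_iInter fun i => isClosed_iInter fun j => isClosed_le (by fun_prop) (by fun_prop)))
  let C : Set (((Fin I → Fin M → ℝ) × (Fin I → Fin N → ℝ)) × ℝ) :=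
    (Metric.sphere 0 1 ×ˢ Set.Icc 0 1) ∩ H
  have hC : IsCompact C := ((isCompact_sphere _ _).prod isCompact_Icc).inter_right hH
  have hmem : ∀ z ∈ D.nearlyFeasibleSet c, 1 ≤ ‖z‖ → (‖z‖⁻¹ • z, ‖z‖⁻¹) ∈ C := by
    intro z hz hz1
    have hp : 0 < ‖z‖ := by linarith
    have hp' : 0 ≤ ‖z‖⁻¹ := (inv_pos.2 hp).le
    refine ⟨⟨?_, hp', inv_le_one_of_one_le₀ hz1⟩, ⟨smul_nonneg hp' fun i => (hz.1 i).1,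
      smul_nonneg hp' fun i => (hz.1 i).2.1⟩, ⟨fun i => ?_, fun i => ?_⟩, fun i j => ?_⟩
    · simp [norm_smul, hp.ne']
    · simp only [Prod.smul_fst, Pi.smul_apply, Matrix.mulVec_smul]
      rw [(hz.1 i).2.2.1]
    · simp only [Prod.smul_fst, Prod.smul_snd, Pi.smul_apply, Matrix.mulVec_smul]
      rw [← smul_add, (hz.1 i).2.2.2]
    · simp only [Prod.smul_fst, Pi.smul_apply]
      rw [← smul_sub, norm_smul, Real.norm_of_nonneg hp']
      exact mul_le_mul_of_nonneg_left (hz.2 i j) hp'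
  rcases C.eq_empty_or_nonempty with hCe | hCne
  · refine isBounded_iff_forall_norm_le.2 ⟨1, fun z hz => ?_⟩
    by_contra! h
    simpa [hCe] using hmem z hz h.le
  · obtain ⟨w, hw, hmin⟩ := hC.exists_isMinOn hCne continuous_snd.continuousOn
    -- At scale zero all first stages agree, so the point is a recession direction of the feasible
    -- set and vanishes, against having norm one.
    have hpos : 0 < w.2 := by
      refine lt_of_le_of_ne hw.1.2.1 fun h0 => ?_
      obtain ⟨⟨hw1, -⟩, ⟨hn1, hn2⟩, ⟨hA, hT⟩, hc⟩ := hw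
      rw [← h0] at hA hT hc
      have hx : ∀ i, w.1.1 i = w.1.1 ⟨0, hI⟩ := fun i => by
        have := hc i ⟨0, hI⟩
        rw [zero_mul] at this
        exact sub_eq_zero.1 (norm_le_zero_iff.1 this)
      have hd := eq_zero_of_recession hX hX_ne (d := (w.1.1 ⟨0, hI⟩, w.1.2)) (hn1 _) hn2
        (by simpa using hA _) (fun i => by simpa [hx i] using hT i)
      have : w.1 = 0 := by
        refine Prod.ext (funext fun i => ?_) (Prod.ext_iff.1 hd).2
        rw [hx i]
        exact (Prod.ext_iff.1 hd).1
      simp [this] at hw1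
    refine isBounded_iff_forall_norm_le.2 ⟨max 1 w.2⁻¹, fun z hz => ?_⟩
    by_cases h : 1 ≤ ‖z‖
    · have h1 : w.2 ≤ ‖z‖⁻¹ := hmin (hmem z hz h)
      exact le_max_of_le_right ((le_inv_comm₀ hpos (by linarith)).1 h1)
    · exact le_max_of_le_left (not_le.1 h).le

/-- Lower semicontinuity of the scalarization value with respect to the relaxation of
nonanticipativity. -/
theorem exists_refValue_sub_lt (hI : 0 < I) (hR : IsMultivariateConvexRiskMeasure R)
    (hX : Bornology.IsBounded D.feasibleSet) (hX_ne : D.feasibleSet.Nonempty)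
    (hv : v ∉ D.upperImage R) {δ : ℝ} (hδ : 0 < δ) :
    ∃ c : ℝ, 0 < c ∧ ∀ z ∈ D.nearlyFeasibleSet c, ∀ α ∈ D.steps R v z.1 z.2,
      D.refValue R v - δ < α := by
  let S : Set ((Fin I → Fin M → ℝ) × (Fin I → Fin N → ℝ)) :=
    {z | D.refValue R v - δ ∈ D.steps R v z.1 z.2}
  have hS : IsClosed S := by
    have : S = (fun z : (Fin I → Fin M → ℝ) × (Fin I → Fin N → ℝ) =>
        fun i j => D.cost z.1 z.2 i j - (v j + (D.refValue R v - δ))) ⁻¹' acceptanceSet R :=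
      Set.ext fun z => mem_steps_iff hR
    rw [this]
    refine IsClosed.preimage ?_ hR.closed
    have hcost : Continuous fun z : (Fin I → Fin M → ℝ) × (Fin I → Fin N → ℝ) =>
        D.cost z.1 z.2 := by
      unfold cost
      fun_prop
    fun_prop
  -- Nested compact sets: a common point would be nonanticipative, hence feasible, with a value `δ`
  -- below the infimum.
  let T : ℕ → Set ((Fin I → Fin M → ℝ) × (Fin I → Fin N → ℝ)) :=
    fun n => D.nearlyFeasibleSet (1 / ((n : ℝ) + 1)) ∩ S
  have hT : ∃ n, T n = ∅ := by
    by_contra! hne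
    obtain ⟨z, hz⟩ := IsCompact.nonempty_iInter_of_sequence_nonempty_isCompact_isClosed T
      (fun n z hz => ⟨⟨hz.1.1, fun i j => (hz.1.2 i j).trans
        (by simpa using Nat.one_div_le_one_div (α := ℝ) (Nat.le_succ n))⟩, hz.2⟩)
      hne ((isCompact_nearlyFeasibleSet hI hX hX_ne _).inter_right hS)
      (fun n => (isClosed_nearlyFeasibleSet _).inter hS)
    rw [Set.mem_iInter] at hz
    have hx : ∀ i, z.1 i = z.1 ⟨0, hI⟩ := fun i => by
      have h0 : ‖z.1 i - z.1 ⟨0, hI⟩‖ ≤ 0 :=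
        ge_of_tendsto' tendsto_one_div_add_atTop_nhds_zero_nat fun n => (hz n).1.2 i _
      exact sub_eq_zero.1 (norm_le_zero_iff.1 h0)
    have hx' : z.1 = fun _ => z.1 ⟨0, hI⟩ := funext hx
    have h1 := (hz 0).1.1
    have h2 : D.refValue R v - δ ∈ D.steps R v z.1 z.2 := (hz 0).2
    rw [hx'] at h2
    have h3 := (isGLB_refValue hR hX_ne hv).1 ⟨(z.1 ⟨0, hI⟩, z.2), ⟨(h1 _).1,
      fun i => (h1 i).2.1, (h1 _).2.2.1, fun i => by
        have := (h1 i).2.2.2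
        rwa [hx i] at this⟩, h2⟩
    linarith
  obtain ⟨n, hn⟩ := hT
  refine ⟨1 / ((n : ℝ) + 1), by positivity, fun z hz α hα => ?_⟩
  by_contra! h
  -- Step sets are upward closed, so any smaller value also admits `refValue - δ`.
  have : z ∈ T n := ⟨hz, mem_steps_of_le hR hα h⟩
  rw [hn] at this
  exact this

/-! ### Weak duality. -/

/-- Points at which the dual objective is finite. -/
structure IsProper (D : StochProgram I J K L M N)
    (R : (Fin I → Fin J → ℝ) → Set (Fin J → ℝ)) (m : Fin I → Fin J → ℝ)
    (lam : Fin I → Fin M → ℝ) : Prop where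
  feasible : D.IsDualFeasible m lam
  penalty_ne_top : penalty R m ≠ ⊤
  bddBelow : ∀ i, BddBelow (D.subObjective i (m i) (lam i) '' D.scenarioSet i)

theorem IsDualFeasible.sum_prob_mul_dotProduct {m : Fin I → Fin J → ℝ} {lam : Fin I → Fin M → ℝ}
    (h : D.IsDualFeasible m lam) (x : Fin M → ℝ) : ∑ i, D.p i * (lam i ⬝ᵥ x) = 0 := by
  have := congrArg (fun w => w ⬝ᵥ x) h.2.2
  rw [sum_dotProduct, zero_dotProduct] at this
  simpa only [smul_dotProduct, smul_eq_mul] using this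

theorem IsDualFeasible.pairing_const {m : Fin I → Fin J → ℝ} {lam : Fin I → Fin M → ℝ}
    (h : D.IsDualFeasible m lam) (c : ℝ) : pairing m (fun _ _ => c) = c := by
  have h1 : pairing m (fun _ _ => c) = (∑ i, ∑ j, m i j) * c := by
    simp [pairing, dotProduct, Finset.sum_mul]
  rw [h1, h.2.1, one_mul]

theorem IsProper.subValue_le {m : Fin I → Fin J → ℝ} {lam : Fin I → Fin M → ℝ}
    (h : D.IsProper R m lam) {i : Fin I} {z : (Fin M → ℝ) × (Fin N → ℝ)}
    (hz : z ∈ D.scenarioSet i) :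
    D.subValue i (m i) (lam i) ≤ D.subObjective i (m i) (lam i) z :=
  csInf_le (h.bddBelow i) (Set.mem_image_of_mem _ hz)

/-- Weak duality. -/
theorem IsProper.dualObjective_le {m : Fin I → Fin J → ℝ} {lam : Fin I → Fin M → ℝ}
    (hR : IsMultivariateConvexRiskMeasure R) (h : D.IsProper R m lam) {α : ℝ}
    (hα : α ∈ D.refValues R v) : D.dualObjective R v m lam ≤ α := by
  obtain ⟨z, hz, hα⟩ := hα
  have h1 := hR.pairing_le_toReal_penalty h.penalty_ne_top ((mem_steps_iff hR).1 hα)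
  have h2 : ∑ i, D.subValue i (m i) (lam i) ≤ ∑ i, D.subObjective i (m i) (lam i) (z.1, z.2 i) :=
    Finset.sum_le_sum fun i _ => h.subValue_le ⟨hz.1, hz.2.1 i, hz.2.2.1, hz.2.2.2 i⟩
  -- The multiplier terms cancel because the first stage is common to all scenarios and `lam` has
  -- mean zero.
  have h3 : ∑ i, D.subObjective i (m i) (lam i) (z.1, z.2 i)
      = pairing m (D.cost (fun _ => z.1) z.2) := by
    simp only [subObjective, Finset.sum_add_distrib, h.feasible.sum_prob_mul_dotProduct, add_zero]
    rfl
  have h4 : (fun i j => D.cost (fun _ => z.1) z.2 i j - (v j + α))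
      = D.cost (fun _ => z.1) z.2 - (fun _ => v) - (fun _ _ => α) := by
    funext i j
    simp only [Pi.sub_apply]
    ring
  rw [h4, pairing_sub_right, pairing_sub_right, h.feasible.pairing_const] at h1
  have h5 : D.dualObjective R v m lam = ∑ i, D.subValue i (m i) (lam i)
    - (penalty R m).toReal - pairing m (fun _ => v) := rfl
  linarith

theorem IsProper.dualObjective_le_refValue {m : Fin I → Fin J → ℝ} {lam : Fin I → Fin M → ℝ}
    (hR : IsMultivariateConvexRiskMeasure R) (hX_ne : D.feasibleSet.Nonempty)
    (hv : v ∉ D.upperImage R) (h : D.IsProper R m lam) :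
    D.dualObjective R v m lam ≤ D.refValue R v :=
  (isGLB_refValue hR hX_ne hv).2 fun _ hα => h.dualObjective_le hR hα

end StochProgram
-- The master problem as a quadratic program with affine constraints.
/-- The master problem variables as a vector space. -/
abbrev MasterSpace (I J M : ℕ) : Type :=
  (Fin I → Fin J → ℝ) × (Fin I → Fin M → ℝ) × (Fin I → ℝ) × ℝ

/-- A vector of master problem variables as a point of the master problem. -/
def MasterSpace.toPoint {I J M : ℕ} (e : MasterSpace I J M) : MasterPoint I J M :=
  ⟨e.1, e.2.1, e.2.2.1, e.2.2.2⟩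

/-- A point of the master problem as a vector. -/
def MasterPoint.toVec {I J M : ℕ} (z : MasterPoint I J M) : MasterSpace I J M :=
  (z.m, z.lam, z.vartheta, z.eta)

namespace StochProgram

variable {I J K L M N : ℕ} {D : StochProgram I J K L M N}
  {R : (Fin I → Fin J → ℝ) → Set (Fin J → ℝ)} {v : Fin J → ℝ}

/-- The cuts `1, …, k` are linear, with the slopes given by the computed solutions. -/
structure HasLinearCuts (D : StochProgram I J K L M N)
    (R : (Fin I → Fin J → ℝ) → Set (Fin J → ℝ)) (s : BundleIterates I J M N) (k : ℕ) : Prop where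
  scenario : ∀ l ∈ Finset.Icc 1 k, ∀ i mi li,
    D.scenarioCut s l i mi li = mi ⬝ᵥ D.cost (s.x l) (s.y l) i + D.p i * (li ⬝ᵥ s.x l i)
  penalty : ∀ l ∈ Finset.Icc 1 k, ∀ m, penaltyCut R s l m = pairing (s.rho l) m

theorem masterObjective_eq (v : Fin J → ℝ) (r : ℝ) (mc : Fin I → Fin J → ℝ)
    (lc : Fin I → Fin M → ℝ) (z : MasterPoint I J M) :
    masterObjective v r mc lc z = ∑ i, z.vartheta i + z.eta - pairing z.m (fun _ => v)
      - r * pairing (z.m - mc) (z.m - mc) - r * pairing (z.lam - lc) (z.lam - lc) := by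
  simp only [masterObjective, pairing, Finset.mul_sum, Pi.sub_apply]

/-- Derivative of the master objective at `z`. -/
def masterSlope (v : Fin J → ℝ) (r : ℝ) (mc : Fin I → Fin J → ℝ)
    (lc : Fin I → Fin M → ℝ) (z : MasterSpace I J M) : MasterSpace I J M →ₗ[ℝ] ℝ where
  toFun w := ∑ i, w.2.2.1 i + w.2.2.2 - pairing w.1 (fun _ => v)
    - 2 * r * pairing w.1 (z.1 - mc) - 2 * r * pairing w.2.1 (z.2.1 - lc)
  map_add' w w' := by
    simp only [Prod.fst_add, Prod.snd_add, pairing_add_left, Pi.add_apply, Finset.sum_add_distrib]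
    ring
  map_smul' c w := by
    simp only [Prod.smul_fst, Prod.smul_snd, pairing_smul_left, Pi.smul_apply, smul_eq_mul,
      ← Finset.mul_sum, RingHom.id_apply]
    ring

theorem masterObjective_add (v : Fin J → ℝ) (r : ℝ) (mc : Fin I → Fin J → ℝ)
    (lc : Fin I → Fin M → ℝ) (z w : MasterSpace I J M) :
    masterObjective v r mc lc (z + w).toPoint = masterObjective v r mc lc z.toPoint
      + masterSlope v r mc lc z w - r * (pairing w.1 w.1 + pairing w.2.1 w.2.1) := by
  have h (a b c : Fin I → Fin J → ℝ) : pairing (a + b - c) (a + b - c)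
      = pairing (a - c) (a - c) + 2 * pairing b (a - c) + pairing b b := by
    rw [show a + b - c = (a - c) + b by abel, pairing_add_left, pairing_add_right,
      pairing_add_right, pairing_comm (a - c) b]
    ring
  have h' (a b c : Fin I → Fin M → ℝ) : pairing (a + b - c) (a + b - c)
      = pairing (a - c) (a - c) + 2 * pairing b (a - c) + pairing b b := by
    rw [show a + b - c = (a - c) + b by abel, pairing_add_left, pairing_add_right,
      pairing_add_right, pairing_comm (a - c) b]
    ring
  rw [masterObjective_eq, masterObjective_eq]
  simp only [MasterSpace.toPoint, masterSlope, LinearMap.coe_mk, AddHom.coe_mk, Prod.fst_add,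
    Prod.snd_add, h, h', pairing_add_left, Pi.add_apply, Finset.sum_add_distrib]
  ring

/-- Indices of the inequality constraints of the master problem with `k` cuts. -/
abbrev IneqIndex (I J k : ℕ) : Type :=
  (Fin I × Finset.Icc 1 k) ⊕ (Finset.Icc 1 k) ⊕ (Fin I × Fin J)

/-- Slack of a scenario cut. -/
def scenarioSlack (D : StochProgram I J K L M N) (s : BundleIterates I J M N) (l : ℕ) (i : Fin I) :
    MasterSpace I J M →ₗ[ℝ] ℝ where
  toFun e := e.1 i ⬝ᵥ D.cost (s.x l) (s.y l) i + D.p i * (e.2.1 i ⬝ᵥ s.x l i) - e.2.2.1 i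
  map_add' w w' := by
    simp only [Prod.fst_add, Prod.snd_add, Pi.add_apply, add_dotProduct]
    ring
  map_smul' c w := by
    simp only [Prod.smul_fst, Prod.smul_snd, Pi.smul_apply, smul_eq_mul, smul_dotProduct,
      RingHom.id_apply]
    ring

/-- Slack of a penalty cut. -/
def penaltySlack (s : BundleIterates I J M N) (l : ℕ) : MasterSpace I J M →ₗ[ℝ] ℝ where
  toFun e := pairing (s.rho l) e.1 - e.2.2.2
  map_add' w w' := by
    simp only [Prod.fst_add, Prod.snd_add, pairing_add_right]
    ring
  map_smul' c w := by
    simp only [Prod.smul_fst, Prod.smul_snd, smul_eq_mul, pairing_smul_right, RingHom.id_apply]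
    ring

/-- The component `m i j` of the master problem variables. -/
def massCoord (i : Fin I) (j : Fin J) : MasterSpace I J M →ₗ[ℝ] ℝ where
  toFun e := e.1 i j
  map_add' _ _ := rfl
  map_smul' _ _ := rfl

/-- A component of the expectation of `lam`. -/
def meanCoord (D : StochProgram I J K L M N) (j : Fin M) : MasterSpace I J M →ₗ[ℝ] ℝ where
  toFun e := ∑ i, D.p i * e.2.1 i j
  map_add' w w' := by
    simp only [Prod.fst_add, Prod.snd_add, Pi.add_apply, mul_add, Finset.sum_add_distrib]
  map_smul' c w := by
    simp only [Prod.smul_fst, Prod.smul_snd, Pi.smul_apply, smul_eq_mul, RingHom.id_apply,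
      Finset.mul_sum]
    exact Finset.sum_congr rfl fun i _ => by ring

/-- Total mass of `m`. -/
def totalMass : MasterSpace I J M →ₗ[ℝ] ℝ where
  toFun e := ∑ i, ∑ j, e.1 i j
  map_add' w w' := by
    simp only [Prod.fst_add, Pi.add_apply, Finset.sum_add_distrib]
  map_smul' c w := by
    simp only [Prod.smul_fst, Pi.smul_apply, smul_eq_mul, RingHom.id_apply, Finset.mul_sum]

/-- Linear inequality constraints of the master problem. -/
def ineqMap (D : StochProgram I J K L M N) (s : BundleIterates I J M N) (k : ℕ) :
    IneqIndex I J k → MasterSpace I J M →ₗ[ℝ] ℝ :=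
  Sum.elim (fun q => D.scenarioSlack s q.2 q.1)
    (Sum.elim (fun l => penaltySlack s l) fun q => massCoord q.1 q.2)

/-- Linear parts of the equality constraints of the master problem. -/
def eqMap (D : StochProgram I J K L M N) : Fin M ⊕ Unit → MasterSpace I J M →ₗ[ℝ] ℝ :=
  Sum.elim (fun j => D.meanCoord j) fun _ => totalMass

/-- Constant parts of the equality constraints of the master problem. -/
def eqConst (M : ℕ) : Fin M ⊕ Unit → ℝ := Sum.elim 0 fun _ => -1

theorem HasLinearCuts.isMasterFeasible_iff {s : BundleIterates I J M N} {k : ℕ}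
    (h : D.HasLinearCuts R s k) (e : MasterSpace I J M) :
    D.IsMasterFeasible R s k e.toPoint ↔
      (∀ j, 0 ≤ D.ineqMap s k j e) ∧ ∀ j, D.eqMap j e + eqConst M j = 0 := by
  constructor
  · rintro ⟨h1, h2, h3, h4, h5⟩
    refine ⟨?_, ?_⟩
    · rintro (⟨i, l, hl⟩ | ⟨l, hl⟩ | ⟨i, j⟩)
      · have := h1 i l hl
        rw [h.scenario l hl] at this
        exact sub_nonneg.2 this
      · have := h2 l hl
        rw [h.penalty l hl] at this
        exact sub_nonneg.2 this
      · exact h3 i j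
    · rintro (j | _)
      · have := congrFun h5 j
        simpa [eqMap, eqConst, meanCoord, MasterSpace.toPoint] using this
      · exact add_neg_eq_zero.2 h4
  · rintro ⟨h1, h2⟩
    refine ⟨fun i l hl => ?_, fun l hl => ?_, fun i j => h1 (Sum.inr (Sum.inr (i, j))),
      add_neg_eq_zero.1 (h2 (Sum.inr ())), funext fun j => ?_⟩
    · rw [h.scenario l hl]
      exact sub_nonneg.1 (h1 (Sum.inl (i, ⟨l, hl⟩)))
    · rw [h.penalty l hl]
      exact sub_nonneg.1 (h1 (Sum.inr (Sum.inl ⟨l, hl⟩)))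
    · have := h2 (Sum.inl j)
      simpa [eqMap, eqConst, meanCoord, MasterSpace.toPoint] using this

/-- First-order optimality condition of the master problem. -/
theorem IsMasterOptimal.masterSlope_nonpos {s : BundleIterates I J M N} {k : ℕ} {r : ℝ}
    (hc : D.HasLinearCuts R s k) {z : MasterSpace I J M}
    (hz : D.IsMasterOptimal R v r s k z.toPoint) {z' : MasterSpace I J M}
    (hz' : D.IsMasterFeasible R s k z'.toPoint) :
    masterSlope v r (s.mbar k) (s.lambar k) z (z' - z) ≤ 0 := by
  -- Along the segment from `z` to `z'` the objective changes by `t * slope - t ^ 2 * q`, which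
  -- optimality of `z` makes nonpositive.
  refine nonpos_of_forall_mul_le_sq (q := r * (pairing (z' - z).1 (z' - z).1
    + pairing (z' - z).2.1 (z' - z).2.1)) fun t ht ht1 => ?_
  have hf : D.IsMasterFeasible R s k (z + t • (z' - z)).toPoint := by
    obtain ⟨h1, h2⟩ := (hc.isMasterFeasible_iff z).1 hz.1
    obtain ⟨h1', h2'⟩ := (hc.isMasterFeasible_iff z').1 hz'
    refine (hc.isMasterFeasible_iff _).2 ⟨fun j => ?_, fun j => ?_⟩
    · have := mul_nonneg (sub_nonneg.2 ht1) (h1 j)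
      have := mul_nonneg ht.le (h1' j)
      rw [map_add, map_smul, map_sub, smul_eq_mul]
      linarith
    · have e1 := h2 j
      have e2 := h2' j
      rw [map_add, map_smul, map_sub, smul_eq_mul]
      linear_combination (1 - t) * e1 + t * e2
  have h1 := hz.2 _ hf
  rw [masterObjective_add, map_smul, smul_eq_mul] at h1
  simp only [Prod.smul_fst, Prod.smul_snd, pairing_smul_left, pairing_smul_right] at h1
  linarith

/-- Strong concavity of the master problem. -/
theorem IsMasterOptimal.masterObjective_le {s : BundleIterates I J M N} {k : ℕ} {r : ℝ}
    (hc : D.HasLinearCuts R s k) {z : MasterPoint I J M} (hz : D.IsMasterOptimal R v r s k z)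
    {z' : MasterPoint I J M} (hz' : D.IsMasterFeasible R s k z') :
    masterObjective v r (s.mbar k) (s.lambar k) z' ≤
      masterObjective v r (s.mbar k) (s.lambar k) z
        - r * (pairing (z'.m - z.m) (z'.m - z.m)
          + pairing (z'.lam - z.lam) (z'.lam - z.lam)) := by
  have h1 := IsMasterOptimal.masterSlope_nonpos hc (z := z.toVec) hz (z' := z'.toVec) hz'
  have h2 := masterObjective_add v r (s.mbar k) (s.lambar k) z.toVec (z'.toVec - z.toVec)
  rw [add_sub_cancel] at h2
  have h3 : masterObjective v r (s.mbar k) (s.lambar k) z'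
    = masterObjective v r (s.mbar k) (s.lambar k) z
      + masterSlope v r (s.mbar k) (s.lambar k) z.toVec (z'.toVec - z.toVec)
      - r * (pairing (z'.m - z.m) (z'.m - z.m)
          + pairing (z'.lam - z.lam) (z'.lam - z.lam)) := h2
  linarith

end StochProgram
-- Estimates along the bundle iterations.
/-- Squared distance between two dual points. -/
def dualDist {I J M : ℕ} (m m' : Fin I → Fin J → ℝ) (lam lam' : Fin I → Fin M → ℝ) : ℝ :=
  pairing (m - m') (m - m') + pairing (lam - lam') (lam - lam')

theorem dualDist_nonneg {I J M : ℕ} (m m' : Fin I → Fin J → ℝ) (lam lam' : Fin I → Fin M → ℝ) :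
    0 ≤ dualDist m m' lam lam' :=
  add_nonneg (pairing_self_nonneg _) (pairing_self_nonneg _)

theorem dualDist_self {I J M : ℕ} (m : Fin I → Fin J → ℝ) (lam : Fin I → Fin M → ℝ) :
    dualDist m m lam lam = 0 := by
  simp [dualDist]

theorem dualDist_comm {I J M : ℕ} (m m' : Fin I → Fin J → ℝ) (lam lam' : Fin I → Fin M → ℝ) :
    dualDist m m' lam lam' = dualDist m' m lam' lam := by
  rw [dualDist, ← neg_sub m' m, ← neg_sub lam' lam]
  simp only [dualDist, pairing_neg_left, pairing_neg_right, neg_neg]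

namespace StochProgram

variable {I J K L M N : ℕ} {D : StochProgram I J K L M N}
  {R : (Fin I → Fin J → ℝ) → Set (Fin J → ℝ)} {v : Fin J → ℝ} {r γ : ℝ}
  {m₁ : Fin I → Fin J → ℝ} {lam₁ : Fin I → Fin M → ℝ} {s : BundleIterates I J M N} {H k : ℕ}

theorem masterObjective_eq_sub_dualDist (v : Fin J → ℝ) (r : ℝ) (mc : Fin I → Fin J → ℝ)
    (lc : Fin I → Fin M → ℝ) (z : MasterPoint I J M) :
    masterObjective v r mc lc z = ∑ i, z.vartheta i + z.eta - ∑ i, z.m i ⬝ᵥ v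
      - r * dualDist z.m mc z.lam lc := by
  rw [masterObjective_eq, dualDist, pairing]
  ring

namespace IsBundleRun

theorem dualFeasible (h : D.IsBundleRun R v r γ m₁ lam₁ s H) (hk : 1 ≤ k) (hkH : k ≤ H) :
    D.IsDualFeasible (s.m k) (s.lam k) := by
  rcases hk.eq_or_lt with rfl | hk
  · rw [h.start.1, h.start.2]
    exact h.start_feasible
  · obtain ⟨k, rfl⟩ := Nat.exists_eq_add_of_le' hk.le
    exact (h.master k (by lia) (by lia)).1.2.2

/-- The computed subproblem solution bounds the subproblem from below and the subgradient forces a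
finite penalty, so neither `sInf` nor `toReal` takes a default value at an iterate. -/
theorem proper (h : D.IsBundleRun R v r γ m₁ lam₁ s H) (hk : 1 ≤ k) (hkH : k ≤ H) :
    D.IsProper R (s.m k) (s.lam k) where
  feasible := h.dualFeasible hk hkH
  penalty_ne_top := (h.subgradient k hk hkH).1
  bddBelow i := by
    refine ⟨D.subObjective i (s.m k i) (s.lam k i) (s.x k i, s.y k i), ?_⟩
    rintro _ ⟨z, hz, rfl⟩
    exact (h.subproblem k hk hkH i).2 hz

theorem subValue_eq (h : D.IsBundleRun R v r γ m₁ lam₁ s H) (hk : 1 ≤ k) (hkH : k ≤ H)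
    (i : Fin I) : D.subValue i (s.m k i) (s.lam k i)
      = D.subObjective i (s.m k i) (s.lam k i) (s.x k i, s.y k i) := by
  obtain ⟨h1, h2⟩ := h.subproblem k hk hkH i
  refine IsLeast.csInf_eq ⟨Set.mem_image_of_mem _ h1, ?_⟩
  rintro _ ⟨z, hz, rfl⟩
  exact h2 hz

theorem hasLinearCuts (h : D.IsBundleRun R v r γ m₁ lam₁ s H)
    (hR : IsMultivariateConvexRiskMeasure R) (hkH : k ≤ H) : D.HasLinearCuts R s k where
  scenario l hl i mi li := by
    rw [Finset.mem_Icc] at hl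
    rw [scenarioCut, h.subValue_eq hl.1 (hl.2.trans hkH)]
    simp only [subObjective, cost, dotProduct_sub, smul_dotProduct, smul_eq_mul]
    rw [dotProduct_comm mi, dotProduct_comm (s.m l i), dotProduct_comm li,
      dotProduct_comm (s.lam l i)]
    ring
  penalty l hl m := by
    rw [Finset.mem_Icc] at hl
    exact hR.penaltyCut_eq (h.subgradient l hl.1 (hl.2.trans hkH))
      (h.dualFeasible hl.1 (hl.2.trans hkH)).1 m

theorem exists_center_eq (h : D.IsBundleRun R v r γ m₁ lam₁ s H) (hk : 1 ≤ k) (hkH : k ≤ H) :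
    ∃ l, 1 ≤ l ∧ l ≤ k ∧ s.mbar k = s.m l ∧ s.lambar k = s.lam l := by
  induction k, hk using Nat.le_induction with
  | base => exact ⟨1, le_rfl, le_rfl, h.descent_step 1 le_rfl hkH (Or.inl rfl)⟩
  | succ k hk ih =>
    by_cases hd : D.IsDescent R v γ s (k + 1)
    · exact ⟨k + 1, by lia, le_rfl, h.descent_step _ (by lia) hkH hd⟩
    · obtain ⟨l, hl1, hlk, e1, e2⟩ := ih (by lia)
      obtain ⟨e3, e4⟩ := h.null_step _ (by lia) hkH hd
      exact ⟨l, hl1, by lia, e3.trans e1, e4.trans e2⟩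

theorem proper_center (h : D.IsBundleRun R v r γ m₁ lam₁ s H) (hk : 1 ≤ k) (hkH : k ≤ H) :
    D.IsProper R (s.mbar k) (s.lambar k) := by
  obtain ⟨l, h1, h2, e1, e2⟩ := h.exists_center_eq hk hkH
  rw [e1, e2]
  exact h.proper h1 (h2.trans hkH)

/-- The cutting-plane model majorizes the dual objective. -/
theorem isMasterFeasible_of_proper (h : D.IsBundleRun R v r γ m₁ lam₁ s H)
    (hR : IsMultivariateConvexRiskMeasure R) (hkH : k ≤ H) {m : Fin I → Fin J → ℝ}
    {lam : Fin I → Fin M → ℝ} (hm : D.IsProper R m lam) :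
    D.IsMasterFeasible R s k
      ⟨m, lam, fun i => D.subValue i (m i) (lam i), -(penalty R m).toReal⟩ := by
  have hc := h.hasLinearCuts hR hkH
  refine ⟨fun i l hl => ?_, fun l hl => ?_, hm.feasible⟩
  · have hl' := Finset.mem_Icc.1 hl
    have h1 := hm.subValue_le (h.subproblem l hl'.1 (hl'.2.trans hkH) i).1
    change D.subValue i (m i) (lam i) ≤ D.scenarioCut s l i (m i) (lam i)
    rwa [hc.scenario l hl]
  · rw [hc.penalty l hl]
    rw [Finset.mem_Icc] at hl
    have := hR.pairing_le_toReal_penalty hm.penalty_ne_top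
      (hR.neg_mem_acceptanceSet (h.subgradient l hl.1 (hl.2.trans hkH))
        (h.dualFeasible hl.1 (hl.2.trans hkH)).1)
    rw [pairing_neg_right, pairing_comm] at this
    change -(penalty R m).toReal ≤ pairing (s.rho l) m
    linarith

/-- Three-point inequality for a proximal step. -/
theorem dualObjective_add_dualDist_le (h : D.IsBundleRun R v r γ m₁ lam₁ s H)
    (hR : IsMultivariateConvexRiskMeasure R) (hk : 1 ≤ k) (hkH : k < H)
    {m : Fin I → Fin J → ℝ} {lam : Fin I → Fin M → ℝ} (hm : D.IsProper R m lam) :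
    D.dualObjective R v m lam + r * dualDist (s.m (k + 1)) (s.mbar k) (s.lam (k + 1)) (s.lambar k)
        + r * dualDist m (s.m (k + 1)) lam (s.lam (k + 1))
      ≤ modelValue v s (k + 1) + r * dualDist m (s.mbar k) lam (s.lambar k) := by
  have h1 := (h.master k hk hkH).masterObjective_le (h.hasLinearCuts hR hkH.le)
    (h.isMasterFeasible_of_proper hR hkH.le hm)
  rw [masterObjective_eq_sub_dualDist, masterObjective_eq_sub_dualDist] at h1
  have h2 : D.dualObjective R v m lam = ∑ i, D.subValue i (m i) (lam i)
    - (penalty R m).toReal - ∑ i, m i ⬝ᵥ v := rfl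
  have h3 : modelValue v s (k + 1) = ∑ i, s.vartheta (k + 1) i + s.eta (k + 1)
    - ∑ i, s.m (k + 1) i ⬝ᵥ v := rfl
  have h4 : dualDist m (s.m (k + 1)) lam (s.lam (k + 1))
    = pairing (m - s.m (k + 1)) (m - s.m (k + 1))
      + pairing (lam - s.lam (k + 1)) (lam - s.lam (k + 1)) := rfl
  dsimp only at h1
  rw [← h4] at h1
  linarith

/-- The predicted increase bounds the step length. -/
theorem centerValue_add_le (h : D.IsBundleRun R v r γ m₁ lam₁ s H)
    (hR : IsMultivariateConvexRiskMeasure R) (hk : 1 ≤ k) (hkH : k < H) :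
    D.centerValue R v s (k + 1)
        + 2 * r * dualDist (s.m (k + 1)) (s.mbar k) (s.lam (k + 1)) (s.lambar k)
      ≤ modelValue v s (k + 1) := by
  -- At the center itself both distances on the left equal the step length, whence the factor 2.
  have h1 := h.dualObjective_add_dualDist_le hR hk hkH (h.proper_center hk hkH.le)
  rw [dualDist_self, dualDist_comm (s.mbar k)] at h1
  have h2 : D.centerValue R v s (k + 1) = D.dualObjective R v (s.mbar k) (s.lambar k) := rfl
  linarith

/-- Up to the stopping iteration, the distance of the centers to a nearly optimal dual point is
controlled by the increase of the dual objective. -/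
theorem dualDist_center_le (h : D.IsBundleRun R v r γ m₁ lam₁ s H)
    (hR : IsMultivariateConvexRiskMeasure R) (hr : 0 < r) (hγ : 0 < γ) {ε η : ℝ} (hε : 0 < ε)
    (hη : 0 < η) (hkH : k < H) (hst : D.IsStoppingIteration R v ε s k)
    {m : Fin I → Fin J → ℝ} {lam : Fin I → Fin M → ℝ} (hm : D.IsProper R m lam)
    (hopt : ∀ m' lam', D.IsProper R m' lam' →
      D.dualObjective R v m' lam' ≤ D.dualObjective R v m lam + η) {j : ℕ} (hj : 1 ≤ j)
    (hjk : j ≤ k) :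
    r * dualDist m (s.mbar j) lam (s.lambar j) ≤ r * dualDist m m₁ lam lam₁
      + (D.dualObjective R v (s.mbar j) (s.lambar j) - D.dualObjective R v m₁ lam₁) / γ
        * (1 + η / ε) := by
  induction j, hj using Nat.le_induction with
  | base =>
    obtain ⟨e1, e2⟩ := h.descent_step 1 le_rfl (by lia) (Or.inl rfl)
    rw [e1, e2, h.start.1, h.start.2]
    simp
  | succ j hj ih =>
    specialize ih (by lia)
    by_cases hd : D.IsDescent R v γ s (j + 1)
    · obtain ⟨e1, e2⟩ := h.descent_step (j + 1) (by lia) (by lia) hd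
      rw [e1, e2]
      have h1 := h.dualObjective_add_dualDist_le hR hj (by lia) hm
      have h2 := hopt _ _ (h.proper_center hj (by lia))
      -- The method has not stopped at `j < k`, so the predicted increase exceeds `ε`.
      have h3 := hst.2.2 j hj (by lia)
      rw [StopCondition, not_le] at h3
      have h4 : (1 - γ) * D.centerValue R v s (j + 1) + γ * modelValue v s (j + 1)
          ≤ D.iterValue R v s (j + 1) := by
        rcases hd with hd | hd
        · lia
        · exact hd.2
      have h5 : D.centerValue R v s (j + 1) = D.dualObjective R v (s.mbar j) (s.lambar j) := rfl
      have h6 : D.iterValue R v s (j + 1)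
        = D.dualObjective R v (s.m (j + 1)) (s.lam (j + 1)) := rfl
      rw [h5] at h3 h4
      rw [h6] at h4
      generalize D.dualObjective R v (s.m (j + 1)) (s.lam (j + 1)) = F' at *
      generalize D.dualObjective R v (s.mbar j) (s.lambar j) = F at *
      generalize modelValue v s (j + 1) = V at *
      have h7 : V - F ≤ (F' - F) / γ := by
        rw [le_div_iff₀ hγ]
        linarith
      -- The actual increase is at least `γ` times the predicted one, hence more than `γ * ε`. The
      -- error `η` is thus charged to the increase of the objective, which telescopes over any
      -- number of descent steps.
      have h8 : η ≤ (F' - F) / γ * (η / ε) := by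
        rw [← mul_div_assoc, le_div_iff₀ hε, mul_comm η ε]
        exact mul_le_mul_of_nonneg_right (h3.le.trans h7) hη.le
      have h9 : (F' - D.dualObjective R v m₁ lam₁) / γ * (1 + η / ε)
        = (F - D.dualObjective R v m₁ lam₁) / γ * (1 + η / ε) + (F' - F) / γ
          + (F' - F) / γ * (η / ε) := by ring
      have h10 := mul_nonneg hr.le
        (dualDist_nonneg (s.m (j + 1)) (s.mbar j) (s.lam (j + 1)) (s.lambar j))
      rw [h9]
      linarith
    · obtain ⟨e1, e2⟩ := h.null_step (j + 1) (by lia) (by lia) hd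
      rw [e1, e2]
      exact ih

/-- Between the stopping iteration and the next descent iteration the centers do not change. -/
theorem center_eq {n : ℕ} (h : D.IsBundleRun R v r γ m₁ lam₁ s H) (hnH : n ≤ H)
    (hkn : k ≤ n) (hnull : ∀ l, k < l → l ≤ n → ¬ D.IsDescent R v γ s l) :
    s.mbar n = s.mbar k ∧ s.lambar n = s.lambar k := by
  induction n, hkn using Nat.le_induction with
  | base => exact ⟨rfl, rfl⟩
  | succ n hn ih =>
    obtain ⟨e1, e2⟩ := h.null_step (n + 1) (by lia) hnH (hnull _ (by lia) le_rfl)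
    obtain ⟨e3, e4⟩ := ih (by lia) fun l h1 h2 => hnull l h1 (by lia)
    exact ⟨e1.trans e3, e2.trans e4⟩

/-- After null steps, the predicted increase and the step length remain controlled by the
tolerance met at the stopping iteration. -/
theorem modelValue_le_of_stopCondition {n : ℕ} (h : D.IsBundleRun R v r γ m₁ lam₁ s (n + 1))
    (hR : IsMultivariateConvexRiskMeasure R) (hr : 0 < r) {ε : ℝ} (hk : 1 ≤ k)
    (hst : D.StopCondition R v ε s k) (hkn : k ≤ n)
    (hnull : ∀ l, k < l → l ≤ n → ¬ D.IsDescent R v γ s l) :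
    r * dualDist (s.m (n + 1)) (s.mbar k) (s.lam (n + 1)) (s.lambar k) ≤ ε ∧
      modelValue v s (n + 1) ≤ D.dualObjective R v (s.mbar k) (s.lambar k) + 2 * ε := by
  obtain ⟨e1, e2⟩ := h.center_eq (by lia) hkn hnull
  obtain ⟨f1, f2, f3⟩ := (h.master n (by lia) (by lia)).1
  -- With the same center and more cuts, the later master solution is feasible for the earlier
  -- master problem, so its regularized value is at most the center value plus `ε`. Combined with
  -- `centerValue_add_le`, which gains two step lengths, this gives both bounds.
  have h1 := (h.master k hk (by lia)).2
    ⟨s.m (n + 1), s.lam (n + 1), s.vartheta (n + 1), s.eta (n + 1)⟩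
    ⟨fun i l hl => f1 i l (Finset.Icc_subset_Icc_right hkn hl),
      fun l hl => f2 l (Finset.Icc_subset_Icc_right hkn hl), f3⟩
  rw [masterObjective_eq_sub_dualDist, masterObjective_eq_sub_dualDist] at h1
  have h2 := h.centerValue_add_le hR (k := n) (by lia) (by lia)
  have h3 : D.centerValue R v s (n + 1) = D.dualObjective R v (s.mbar n) (s.lambar n) := rfl
  have h4 : D.centerValue R v s (k + 1) = D.dualObjective R v (s.mbar k) (s.lambar k) := rfl
  rw [StopCondition, h4] at hst
  rw [h3, e1, e2] at h2
  have h5 : modelValue v s (n + 1) = ∑ i, s.vartheta (n + 1) i + s.eta (n + 1)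
    - ∑ i, s.m (n + 1) i ⬝ᵥ v := rfl
  have h6 : modelValue v s (k + 1) = ∑ i, s.vartheta (k + 1) i + s.eta (k + 1)
    - ∑ i, s.m (k + 1) i ⬝ᵥ v := rfl
  have h7 := mul_nonneg hr.le
    (dualDist_nonneg (s.m (k + 1)) (s.mbar k) (s.lam (k + 1)) (s.lambar k))
  dsimp only at h1
  constructor <;> linarith

end IsBundleRun

end StochProgram
-- Duality and the optimality system of the master problem.
namespace StochProgram

variable {I J K L M N : ℕ} {D : StochProgram I J K L M N}
  {R : (Fin I → Fin J → ℝ) → Set (Fin J → ℝ)} {v : Fin J → ℝ} {r γ : ℝ}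
  {s : BundleIterates I J M N} {k n : ℕ}

/-- Strong duality for the master problem. -/
theorem IsMasterOptimal.exists_multipliers (hr : 0 ≤ r) (hc : D.HasLinearCuts R s k)
    {z : MasterPoint I J M} (hz : D.IsMasterOptimal R v r s k z) :
    ∃ d : MasterMultipliers I J M, IsMasterDualFeasible k d ∧ ∀ z',
      D.masterLagrangian R v r s (s.mbar k) (s.lambar k) k z' d
        ≤ masterObjective v r (s.mbar k) (s.lambar k) z := by
  obtain ⟨h1, h2⟩ := (hc.isMasterFeasible_iff z.toVec).1 hz.1
  -- The solution `z` also maximizes the objective linearized at `z`, so linear programming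
  -- multipliers exist; concavity transfers them to the quadratic objective.
  obtain ⟨μ, μ', hμ, H⟩ := _root_.exists_multipliers (D.ineqMap s k) 0 D.eqMap (eqConst M)
    (masterSlope v r (s.mbar k) (s.lambar k) z.toVec) z.toVec (by simpa using h1) h2
    (fun e he he' => by
      have := IsMasterOptimal.masterSlope_nonpos hc (z := z.toVec) hz (z' := e)
        ((hc.isMasterFeasible_iff e).2 ⟨by simpa using he, he'⟩)
      rw [map_sub] at this
      linarith)
  -- The equality multipliers change sign to match the Lagrangian; multipliers outside the cut range
  -- are irrelevant and set to zero.
  refine ⟨⟨fun i l => if h : l ∈ Finset.Icc 1 k then μ (Sum.inl (i, ⟨l, h⟩)) else 0,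
    fun l => if h : l ∈ Finset.Icc 1 k then μ (Sum.inr (Sum.inl ⟨l, h⟩)) else 0,
    fun j => -μ' (Sum.inl j), -μ' (Sum.inr ()), fun i j => μ (Sum.inr (Sum.inr (i, j)))⟩,
    ⟨fun i l hl => ?_, fun l hl => ?_, fun i j => hμ _⟩, fun z' => ?_⟩
  · dsimp only
    rw [dif_pos hl]
    exact hμ _
  · dsimp only
    rw [dif_pos hl]
    exact hμ _
  · have h3 := H z'.toVec
    have h4 := masterObjective_add v r (s.mbar k) (s.lambar k) z.toVec (z'.toVec - z.toVec)
    rw [add_sub_cancel, map_sub] at h4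
    have h5 : 0 ≤ r * (pairing (z'.toVec - z.toVec).1 (z'.toVec - z.toVec).1
        + pairing (z'.toVec - z.toVec).2.1 (z'.toVec - z.toVec).2.1) :=
      mul_nonneg hr (add_nonneg (pairing_self_nonneg _) (pairing_self_nonneg _))
    change masterObjective v r (s.mbar k) (s.lambar k) z'
      = masterObjective v r (s.mbar k) (s.lambar k) z + _ - _ at h4
    have h6 : (∑ i, ∑ l ∈ Finset.Icc 1 k,
          (if h : l ∈ Finset.Icc 1 k then μ (Sum.inl (i, ⟨l, h⟩)) else 0)
            * (D.scenarioCut s l i (z'.m i) (z'.lam i) - z'.vartheta i))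
        = ∑ q : Fin I × Finset.Icc 1 k,
            μ (Sum.inl q) * D.scenarioSlack s q.2 q.1 z'.toVec := by
      rw [Fintype.sum_prod_type]
      refine Finset.sum_congr rfl fun i _ => ?_
      rw [← Finset.sum_coe_sort]
      refine Finset.sum_congr rfl fun l _ => ?_
      rw [dif_pos l.2, hc.scenario l l.2]
      rfl
    have h7 : (∑ l ∈ Finset.Icc 1 k,
          (if h : l ∈ Finset.Icc 1 k then μ (Sum.inr (Sum.inl ⟨l, h⟩)) else 0)
            * (penaltyCut R s l z'.m - z'.eta))
        = ∑ l : Finset.Icc 1 k, μ (Sum.inr (Sum.inl l)) * penaltySlack s l z'.toVec := by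
      rw [← Finset.sum_coe_sort]
      refine Finset.sum_congr rfl fun l _ => ?_
      rw [dif_pos l.2, hc.penalty l l.2]
      rfl
    have h8 : (fun j => -μ' (Sum.inl j)) ⬝ᵥ (∑ i, D.p i • z'.lam i)
        = -∑ j, μ' (Sum.inl j) * D.meanCoord j z'.toVec := by
      simp [dotProduct, meanCoord, MasterPoint.toVec]
    have h9 : ∑ i, (fun j => μ (Sum.inr (Sum.inr (i, j)))) ⬝ᵥ z'.m i
        = ∑ q : Fin I × Fin J, μ (Sum.inr (Sum.inr q)) * massCoord q.1 q.2 z'.toVec := by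
      rw [Fintype.sum_prod_type]
      rfl
    have h10 : ∑ i, ∑ j, z'.m i j = totalMass z'.toVec := rfl
    simp only [Fintype.sum_sum_type, ineqMap, eqMap, eqConst, Sum.elim_inl, Sum.elim_inr,
      Pi.zero_apply, add_zero, Finset.univ_unique, Finset.sum_singleton] at h3
    simp only [masterLagrangian]
    rw [h6, h7, h8, h9, h10]
    have h11 : ∀ (q : Unit), μ' (Sum.inr q) = μ' (Sum.inr ()) := fun _ => rfl
    rw [h11] at h3
    linarith

/-- The Lagrangian of the master problem, collected by variables. -/
theorem HasLinearCuts.masterLagrangian_eq (hc : D.HasLinearCuts R s n)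
    (mc : Fin I → Fin J → ℝ) (lc : Fin I → Fin M → ℝ) (d : MasterMultipliers I J M)
    (e : MasterSpace I J M) :
    D.masterLagrangian R v r s mc lc n e.toPoint d = masterObjective v r mc lc e.toPoint
      + pairing (D.cost (recoveredX s n d) (recoveredY s n d)
          + ∑ l ∈ Finset.Icc 1 n, d.theta l • s.rho l - (fun _ _ => d.psi) + d.nu) e.1
      + pairing (fun i => D.p i • (recoveredX s n d i - d.sigma)) e.2.1
      - ∑ i, (∑ l ∈ Finset.Icc 1 n, d.tau i l) * e.2.2.1 i
      - (∑ l ∈ Finset.Icc 1 n, d.theta l) * e.2.2.2 + d.psi := by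
  have h1 : ∑ i, ∑ l ∈ Finset.Icc 1 n,
      d.tau i l * (D.scenarioCut s l i (e.1 i) (e.2.1 i) - e.2.2.1 i)
      = pairing (D.cost (recoveredX s n d) (recoveredY s n d)) e.1
        + pairing (fun i => D.p i • recoveredX s n d i) e.2.1
        - ∑ i, (∑ l ∈ Finset.Icc 1 n, d.tau i l) * e.2.2.1 i := by
    simp only [pairing]
    rw [← Finset.sum_add_distrib, ← Finset.sum_sub_distrib]
    refine Finset.sum_congr rfl fun i _ => ?_
    have h2 : D.cost (recoveredX s n d) (recoveredY s n d) i
        = ∑ l ∈ Finset.Icc 1 n, d.tau i l • D.cost (s.x l) (s.y l) i := by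
      simp only [cost, recoveredX, recoveredY, Matrix.mulVec_sum, Matrix.mulVec_smul, smul_add,
        Finset.sum_add_distrib]
    rw [h2, sum_dotProduct, smul_dotProduct, recoveredX, sum_dotProduct, Finset.smul_sum,
      Finset.sum_mul, ← Finset.sum_add_distrib, ← Finset.sum_sub_distrib]
    refine Finset.sum_congr rfl fun l hl => ?_
    rw [hc.scenario l hl, smul_dotProduct, smul_dotProduct, dotProduct_comm (e.1 i),
      dotProduct_comm (e.2.1 i)]
    simp only [smul_eq_mul]
    ring
  have h3 : ∑ l ∈ Finset.Icc 1 n, d.theta l * (penaltyCut R s l e.1 - e.2.2.2)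
      = pairing (∑ l ∈ Finset.Icc 1 n, d.theta l • s.rho l) e.1
        - (∑ l ∈ Finset.Icc 1 n, d.theta l) * e.2.2.2 := by
    rw [pairing_sum_left, Finset.sum_mul, ← Finset.sum_sub_distrib]
    refine Finset.sum_congr rfl fun l hl => ?_
    rw [hc.penalty l hl, pairing_smul_left]
    ring
  have h4 : pairing (fun i => D.p i • (recoveredX s n d i - d.sigma)) e.2.1
      = pairing (fun i => D.p i • recoveredX s n d i) e.2.1
        - d.sigma ⬝ᵥ ∑ i, D.p i • e.2.1 i := by
    simp only [pairing, smul_sub, sub_dotProduct, Finset.sum_sub_distrib, dotProduct_sum,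
      smul_dotProduct, dotProduct_smul]
  have h5 : pairing (fun _ _ => d.psi) e.1 = d.psi * ∑ i, ∑ j, e.1 i j := by
    simp [pairing, dotProduct, Finset.mul_sum]
  have h6 : ∑ i, d.nu i ⬝ᵥ e.1 i = pairing d.nu e.1 := rfl
  simp only [masterLagrangian, MasterSpace.toPoint]
  rw [h1, h3, h4, pairing_add_left, pairing_sub_left, pairing_add_left, h5, h6]
  ring

/-- Optimality system satisfied by a solution of the master problem and Lagrange multipliers. -/
structure IsKKT (D : StochProgram I J K L M N) (v : Fin J → ℝ) (r : ℝ)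
    (s : BundleIterates I J M N) (mc : Fin I → Fin J → ℝ) (lc : Fin I → Fin M → ℝ) (n : ℕ)
    (z : MasterPoint I J M) (d : MasterMultipliers I J M) : Prop where
  sum_tau : ∀ i, ∑ l ∈ Finset.Icc 1 n, d.tau i l = 1
  sum_theta : ∑ l ∈ Finset.Icc 1 n, d.theta l = 1
  stationary_m : D.cost (recoveredX s n d) (recoveredY s n d)
    + ∑ l ∈ Finset.Icc 1 n, d.theta l • s.rho l - (fun _ _ => d.psi) + d.nu
    = (fun _ => v) + (2 * r) • (z.m - mc)
  stationary_lam : (fun i => D.p i • (recoveredX s n d i - d.sigma)) = (2 * r) • (z.lam - lc)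
  modelValue_eq : ∑ i, z.vartheta i + z.eta - pairing z.m (fun _ => v)
    = d.psi + 2 * r * pairing (z.m - mc) z.m + 2 * r * pairing (z.lam - lc) z.lam

/-- With zero duality gap the primal solution maximizes the Lagrangian of every dual optimal `d`, so
the gradient vanishes there; the equality of the Lagrangian with the objective is complementary
slackness. -/
theorem IsMasterDualOptimal.isKKT (hr : 0 ≤ r) (hc : D.HasLinearCuts R s n)
    {z : MasterPoint I J M} (hz : D.IsMasterOptimal R v r s n z) {d : MasterMultipliers I J M}
    (hd : D.IsMasterDualOptimal R v r s (s.mbar n) (s.lambar n) n d) :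
    D.IsKKT v r s (s.mbar n) (s.lambar n) n z d := by
  set mc := s.mbar n
  set lc := s.lambar n
  obtain ⟨d', hd', hd'L⟩ := hz.exists_multipliers hr hc
  have hL : ∀ z', D.masterLagrangian R v r s mc lc n z' d ≤ masterObjective v r mc lc z := by
    intro z'
    rw [← EReal.coe_le_coe_iff]
    refine (le_iSup (fun z : MasterPoint I J M =>
      ((D.masterLagrangian R v r s mc lc n z d : ℝ) : EReal)) z').trans ((hd.2 d' hd').trans ?_)
    exact iSup_le fun z'' => EReal.coe_le_coe_iff.2 (hd'L z'')
  have hLz : masterObjective v r mc lc z ≤ D.masterLagrangian R v r s mc lc n z d := by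
    obtain ⟨f1, f2, f3, f4, f5⟩ := hz.1
    have g1 : 0 ≤ ∑ i, ∑ l ∈ Finset.Icc 1 n,
        d.tau i l * (D.scenarioCut s l i (z.m i) (z.lam i) - z.vartheta i) :=
      Finset.sum_nonneg fun i _ => Finset.sum_nonneg fun l hl =>
        mul_nonneg (hd.1.1 i l hl) (sub_nonneg.2 (f1 i l hl))
    have g2 : 0 ≤ ∑ l ∈ Finset.Icc 1 n, d.theta l * (penaltyCut R s l z.m - z.eta) :=
      Finset.sum_nonneg fun l hl => mul_nonneg (hd.1.2.1 l hl) (sub_nonneg.2 (f2 l hl))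
    have g3 : 0 ≤ ∑ i, d.nu i ⬝ᵥ z.m i := pairing_nonneg hd.1.2.2 f3
    rw [masterLagrangian, f4, f5, dotProduct_zero]
    linarith
  have hEq := le_antisymm (hL z) hLz
  have hexp := hc.masterLagrangian_eq (v := v) (r := r) mc lc d
  set B := D.cost (recoveredX s n d) (recoveredY s n d)
    + ∑ l ∈ Finset.Icc 1 n, d.theta l • s.rho l - (fun _ _ => d.psi) + d.nu with hB
  set X : Fin I → Fin M → ℝ := fun i => D.p i • (recoveredX s n d i - d.sigma) with hX
  set τ : Fin I → ℝ := fun i => ∑ l ∈ Finset.Icc 1 n, d.tau i l with hτ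
  set θ := ∑ l ∈ Finset.Icc 1 n, d.theta l with hθ
  -- `G` is the gradient of the Lagrangian at `z`. Moving by `t • G` changes it by `t * ‖G‖²` minus
  -- a multiple of `t ^ 2`, so maximality forces `G = 0`.
  let G : MasterSpace I J M := (B - (fun _ => v) - (2 * r) • (z.m - mc),
    X - (2 * r) • (z.lam - lc), fun i => 1 - τ i, 1 - θ)
  have hG : pairing G.1 G.1 + pairing G.2.1 G.2.1 + ∑ i, (1 - τ i) ^ 2 + (1 - θ) ^ 2 ≤ 0 := by
    refine nonpos_of_forall_mul_le_sq (q := r * (pairing G.1 G.1 + pairing G.2.1 G.2.1))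
      fun t _ _ => ?_
    have h1 := hL (z.toVec + t • G).toPoint
    have h2 : D.masterLagrangian R v r s mc lc n z.toVec.toPoint d
      = masterObjective v r mc lc z.toVec.toPoint := hEq
    rw [← show masterObjective v r mc lc z.toVec.toPoint = masterObjective v r mc lc z from rfl,
      ← h2, hexp, hexp, masterObjective_add, map_smul, smul_eq_mul] at h1
    simp only [Prod.fst_add, Prod.snd_add, Prod.smul_fst, Prod.smul_snd, pairing_add_right,
      pairing_smul_left, pairing_smul_right, Pi.add_apply, Pi.smul_apply, mul_add,
      Finset.sum_add_distrib, smul_eq_mul] at h1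
    have h3 : masterSlope v r mc lc z.toVec G = ∑ i, (1 - τ i) + (1 - θ)
      - pairing G.1 (fun _ => v) - 2 * r * pairing G.1 (z.m - mc)
      - 2 * r * pairing G.2.1 (z.lam - lc) := rfl
    have h4 : pairing G.1 G.1 = pairing B G.1 - pairing G.1 (fun _ => v)
        - 2 * r * pairing G.1 (z.m - mc) := by
      conv_lhs => rw [show G.1 = B - (fun _ => v) - (2 * r) • (z.m - mc) from rfl]
      rw [pairing_sub_left, pairing_sub_left, pairing_smul_left]
      change pairing B G.1 - pairing (fun _ => v) G.1 - 2 * r * pairing (z.m - mc) G.1 = _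
      rw [pairing_comm (fun _ => v), pairing_comm (z.m - mc)]
    have h5 : pairing G.2.1 G.2.1 = pairing X G.2.1
        - 2 * r * pairing G.2.1 (z.lam - lc) := by
      conv_lhs => rw [show G.2.1 = X - (2 * r) • (z.lam - lc) from rfl]
      rw [pairing_sub_left, pairing_smul_left]
      change pairing X G.2.1 - 2 * r * pairing (z.lam - lc) G.2.1 = _
      rw [pairing_comm (z.lam - lc)]
    have h6 : ∑ i, (1 - τ i) ^ 2 = ∑ i, (1 - τ i) - ∑ i, τ i * (1 - τ i) := by
      rw [← Finset.sum_sub_distrib]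
      exact Finset.sum_congr rfl fun i _ => by ring
    have h7 : ∑ i, τ i * (t * G.2.2.1 i) = t * ∑ i, τ i * (1 - τ i) := by
      rw [Finset.mul_sum]
      exact Finset.sum_congr rfl fun i _ => by
        change τ i * (t * (1 - τ i)) = _
        ring
    have h8 : G.2.2.2 = 1 - θ := rfl
    rw [h3, h7, h8] at h1
    rw [h6]
    linear_combination h1 + t * h4 + t * h5
  have g1 := pairing_self_nonneg G.1
  have g2 := pairing_self_nonneg G.2.1
  have g3 : 0 ≤ ∑ i, (1 - τ i) ^ 2 := Finset.sum_nonneg fun i _ => sq_nonneg _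
  have g4 := sq_nonneg (1 - θ)
  have e1 : B - (fun _ => v) - (2 * r) • (z.m - mc) = 0 :=
    eq_zero_of_pairing_self_eq_zero (u := G.1) (by linarith)
  have e2 : X - (2 * r) • (z.lam - lc) = 0 :=
    eq_zero_of_pairing_self_eq_zero (u := G.2.1) (by linarith)
  have e3 : ∀ i, τ i = 1 := fun i => by
    have h1 : ∑ i, (1 - τ i) ^ 2 = 0 := by linarith
    have h2 := (Finset.sum_eq_zero_iff_of_nonneg fun i _ => sq_nonneg _).1 h1 i (Finset.mem_univ i)
    have := pow_eq_zero_iff (two_ne_zero) |>.1 h2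
    linarith
  have e4 : θ = 1 := by
    have := (pow_eq_zero_iff (two_ne_zero)).1 (show (1 - θ) ^ 2 = 0 by linarith)
    linarith
  have e1' : B = (fun _ => v) + (2 * r) • (z.m - mc) := by
    rw [sub_sub, sub_eq_zero] at e1
    exact e1
  have e2' : X = (2 * r) • (z.lam - lc) := sub_eq_zero.1 e2
  refine ⟨e3, e4, e1', e2', ?_⟩
  -- The Lagrangian equals the master objective at `z`, so the remaining terms of its expansion sum
  -- to zero; this yields the model value.
  have h1 := hexp z.toVec
  rw [show z.toVec.toPoint = z from rfl, hEq, e1', e2'] at h1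
  have h2 : ∑ i, τ i * z.toVec.2.2.1 i = ∑ i, z.vartheta i :=
    Finset.sum_congr rfl fun i _ => by
      rw [e3 i, one_mul]
      rfl
  rw [h2, e4, pairing_add_left, pairing_smul_left, pairing_smul_left] at h1
  change _ = _ + (pairing (fun _ => v) z.m + 2 * r * pairing (z.m - mc) z.m)
    + 2 * r * pairing (z.lam - lc) z.lam - _ - 1 * z.eta + _ at h1
  rw [pairing_comm (fun _ => v)] at h1
  linarith

theorem convex_scenarioSet (i : Fin I) : Convex ℝ (D.scenarioSet i) := by
  rintro z ⟨h1, h2, h3, h4⟩ z' ⟨h1', h2', h3', h4'⟩ a b ha hb hab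
  refine ⟨add_nonneg (smul_nonneg ha h1) (smul_nonneg hb h1'),
    add_nonneg (smul_nonneg ha h2) (smul_nonneg hb h2'), ?_, ?_⟩
  · simp only [Prod.fst_add, Prod.smul_fst, Matrix.mulVec_add, Matrix.mulVec_smul, h3, h3']
    rw [← add_smul, hab, one_smul]
  · simp only [Prod.fst_add, Prod.smul_fst, Prod.snd_add, Prod.smul_snd, Matrix.mulVec_add,
      Matrix.mulVec_smul]
    rw [add_add_add_comm, ← smul_add, ← smul_add, h4, h4', ← add_smul, hab, one_smul]

end StochProgram
-- Bounds for the recovered solution.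
namespace StochProgram

variable {I J K L M N : ℕ} {D : StochProgram I J K L M N}
  {R : (Fin I → Fin J → ℝ) → Set (Fin J → ℝ)} {v : Fin J → ℝ} {r γ ε : ℝ}
  {m₁ : Fin I → Fin J → ℝ} {lam₁ : Fin I → Fin M → ℝ} {s : BundleIterates I J M N} {k n : ℕ}
  {d : MasterMultipliers I J M}

namespace IsRecovery

theorem isKKT (h : D.IsRecovery R v r γ m₁ lam₁ ε s k n d)
    (hR : IsMultivariateConvexRiskMeasure R) (hr : 0 ≤ r) :
    D.IsKKT v r s (s.mbar k) (s.lambar k) n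
      ⟨s.m (n + 1), s.lam (n + 1), s.vartheta (n + 1), s.eta (n + 1)⟩ d := by
  have hk := h.stopping.1
  have hkn := h.next.1
  obtain ⟨e1, e2⟩ := h.run.center_eq (by lia) hkn h.next.2.2
  have hd := h.dual
  rw [← e1, ← e2] at hd ⊢
  exact hd.isKKT hr (h.run.hasLinearCuts hR (by lia)) (h.run.master n (by lia) (by lia))

/-- The recovered decisions are feasible in each scenario. -/
theorem mem_scenarioSet (h : D.IsRecovery R v r γ m₁ lam₁ ε s k n d)
    (hR : IsMultivariateConvexRiskMeasure R) (hr : 0 ≤ r) (i : Fin I) :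
    (recoveredX s n d i, recoveredY s n d i) ∈ D.scenarioSet i := by
  have h1 : (recoveredX s n d i, recoveredY s n d i)
      = ∑ l ∈ Finset.Icc 1 n, d.tau i l • (s.x l i, s.y l i) := by
    refine Prod.ext ?_ ?_
    · simp [recoveredX, Prod.fst_sum]
    · simp [recoveredY, Prod.snd_sum]
  rw [h1]
  refine (convex_scenarioSet i).sum_mem (h.dual.1.1 i) ((h.isKKT hR hr).sum_tau i) fun l hl => ?_
  rw [Finset.mem_Icc] at hl
  exact (h.run.subproblem l hl.1 (by lia) i).1

/-- The aggregated subgradients of the penalty are acceptable. -/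
theorem neg_sum_mem_acceptanceSet (h : D.IsRecovery R v r γ m₁ lam₁ ε s k n d)
    (hR : IsMultivariateConvexRiskMeasure R) (hr : 0 ≤ r) :
    -∑ l ∈ Finset.Icc 1 n, d.theta l • s.rho l ∈ acceptanceSet R := by
  have h1 : -∑ l ∈ Finset.Icc 1 n, d.theta l • s.rho l
      = ∑ l ∈ Finset.Icc 1 n, d.theta l • -s.rho l := by
    simp [Finset.sum_neg_distrib]
  rw [h1]
  refine hR.convex_acceptanceSet.sum_mem h.dual.1.2.1 (h.isKKT hR hr).sum_theta fun l hl => ?_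
  rw [Finset.mem_Icc] at hl
  exact hR.neg_mem_acceptanceSet (h.run.subgradient l hl.1 (by lia))
    (h.run.dualFeasible hl.1 (by lia)).1

/-- The recovered first-stage decisions are close to the multiplier `sigma`. -/
theorem abs_recoveredX_sub_le (h : D.IsRecovery R v r γ m₁ lam₁ ε s k n d)
    (hp : ∀ i, 0 < D.p i) (hR : IsMultivariateConvexRiskMeasure R) (hr : 0 < r) (i : Fin I) :
    ‖recoveredX s n d i - d.sigma‖ ≤ 2 * r * √(ε / r) / D.p i := by
  have hkkt := h.isKKT hR hr.le
  obtain ⟨h1, -⟩ := h.run.modelValue_le_of_stopCondition hR hr h.stopping.1 h.stopping.2.1 h.next.1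
    h.next.2.2
  have hpi := hp i
  refine (pi_norm_le_iff_of_nonneg (by positivity)).2 fun j => ?_
  have h2 : D.p i * (recoveredX s n d i - d.sigma) j
      = 2 * r * (s.lam (n + 1) - s.lambar k) i j :=
    congrFun (congrFun hkkt.stationary_lam i) j
  rw [Real.norm_eq_abs, le_div_iff₀ hpi, mul_comm, ← abs_of_pos hpi, ← abs_mul, h2, abs_mul,
    abs_of_pos (show 0 < 2 * r by linarith)]
  refine mul_le_mul_of_nonneg_left ?_ (by linarith)
  refine (abs_le_sqrt_pairing_self _ i j).trans (Real.sqrt_le_sqrt ?_)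
  rw [le_div_iff₀ hr]
  have h3 := pairing_self_nonneg (s.m (n + 1) - s.mbar k)
  rw [dualDist, mul_add] at h1
  have := mul_nonneg hr.le h3
  linarith

/-- The step length provided by the multiplier `psi`. -/
theorem psi_add_mem_steps (h : D.IsRecovery R v r γ m₁ lam₁ ε s k n d)
    (hR : IsMultivariateConvexRiskMeasure R) (hr : 0 < r) :
    d.psi + 2 * r * √(pairing (s.m (n + 1) - s.mbar k) (s.m (n + 1) - s.mbar k))
      ∈ D.steps R v (recoveredX s n d) (recoveredY s n d) := by
  rw [mem_steps_iff hR]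
  -- By stationarity in `m` and `nu ≥ 0`, the shifted cost is dominated by the acceptable aggregate
  -- `-∑ theta • rho`; the term with the square root absorbs the proximal residual coordinatewise.
  refine hR.isLowerSet_acceptanceSet (fun i j => ?_) (h.neg_sum_mem_acceptanceSet hR hr.le)
  have h1 := congrFun (congrFun (h.isKKT hR hr.le).stationary_m i) j
  have h2 := (le_abs_self _).trans (abs_le_sqrt_pairing_self (s.m (n + 1) - s.mbar k) i j)
  have h3 := h.dual.1.2.2 i j
  have h4 := mul_le_mul_of_nonneg_left h2 (show 0 ≤ 2 * r by linarith)
  simp only [Pi.add_apply, Pi.sub_apply, Pi.smul_apply, smul_eq_mul, Pi.neg_apply,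
    Pi.zero_apply] at h1 h3 h4 ⊢
  linarith

/-- Bound of the recovered step length by the dual objective at the center. -/
theorem recoveredAlpha_le (h : D.IsRecovery R v r γ m₁ lam₁ ε s k n d)
    (hR : IsMultivariateConvexRiskMeasure R) (hr : 0 < r) (m : Fin I → Fin J → ℝ)
    (lam : Fin I → Fin M → ℝ) :
    recoveredAlpha D R v s n d ≤ D.dualObjective R v (s.mbar k) (s.lambar k) + 2 * ε
      + 4 * r * √(ε / r) + 2 * r * (√(ε / r) * √(dualDist m (s.mbar k) lam (s.lambar k)))
      + 2 * r * (√(ε / r) * √(pairing lam lam)) := by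
  obtain ⟨h1, h2⟩ := h.run.modelValue_le_of_stopCondition hR hr h.stopping.1 h.stopping.2.1 h.next.1
    h.next.2.2
  have hα : recoveredAlpha D R v s n d ≤ _ :=
    csInf_le (steps_bddBelow hR _ _) (h.psi_add_mem_steps hR hr)
  have h3 : modelValue v s (n + 1) = d.psi
      + 2 * r * pairing (s.m (n + 1) - s.mbar k) (s.m (n + 1))
      + 2 * r * pairing (s.lam (n + 1) - s.lambar k) (s.lam (n + 1)) :=
    (h.isKKT hR hr.le).modelValue_eq
  have hf := h.run.dualFeasible (k := n + 1) (by lia) le_rfl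
  set m' := s.m (n + 1)
  set l' := s.lam (n + 1)
  have hS : dualDist m' (s.mbar k) l' (s.lambar k) ≤ ε / r := by
    rw [le_div_iff₀ hr]
    linarith
  rw [dualDist] at hS
  have hS1 := pairing_self_nonneg (m' - s.mbar k)
  have hS2 := pairing_self_nonneg (l' - s.lambar k)
  have hm : √(pairing (m' - s.mbar k) (m' - s.mbar k)) ≤ √(ε / r) :=
    Real.sqrt_le_sqrt (by linarith)
  have hl : √(pairing (l' - s.lambar k) (l' - s.lambar k)) ≤ √(ε / r) :=
    Real.sqrt_le_sqrt (by linarith)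
  -- `m'` is nonnegative with total mass one, so pairing it with a vector of entries at least `-√(ε
  -- / r)` loses no more than that.
  have h4 : -√(ε / r) ≤ pairing (m' - s.mbar k) m' := by
    have h5 : 0 ≤ pairing m' (m' - s.mbar k + fun _ _ => √(ε / r)) :=
      pairing_nonneg hf.1 fun i j => by
        have := neg_le_of_abs_le ((abs_le_sqrt_pairing_self (m' - s.mbar k) i j).trans hm)
        simp only [Pi.add_apply, Pi.zero_apply]
        linarith
    rw [pairing_add_right, hf.pairing_const, pairing_comm] at h5
    linarith
  -- No bound on `l'` is available; it is split as `(l' - center) - (lam - center) + lam`, so that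
  -- only the distance from the center to the reference point enters.
  have h5 : -(√(ε / r) * √(dualDist m (s.mbar k) lam (s.lambar k)))
      - √(ε / r) * √(pairing lam lam) ≤ pairing (l' - s.lambar k) l' := by
    have g1 : pairing (l' - s.lambar k) l' = pairing (l' - s.lambar k) (l' - s.lambar k)
        - pairing (l' - s.lambar k) (lam - s.lambar k) + pairing (l' - s.lambar k) lam := by
      rw [← pairing_sub_right, ← pairing_add_right]
      congr 1
      abel
    have g2 : |pairing (l' - s.lambar k) (lam - s.lambar k)|
        ≤ √(ε / r) * √(dualDist m (s.mbar k) lam (s.lambar k)) :=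
      (abs_pairing_le _ _).trans (mul_le_mul hl
        (Real.sqrt_le_sqrt (le_add_of_nonneg_left (pairing_self_nonneg _)))
        (Real.sqrt_nonneg _) (Real.sqrt_nonneg _))
    have g3 : |pairing (l' - s.lambar k) lam| ≤ √(ε / r) * √(pairing lam lam) :=
      (abs_pairing_le _ _).trans (mul_le_mul_of_nonneg_right hl (Real.sqrt_nonneg _))
    have g4 := le_of_abs_le g2
    have g5 := neg_le_of_abs_le g3
    linarith
  have h2r : 0 ≤ 2 * r := by linarith
  have k1 := mul_le_mul_of_nonneg_left hm h2r
  have k2 := mul_le_mul_of_nonneg_left h4 h2r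
  have k3 := mul_le_mul_of_nonneg_left h5 h2r
  linarith

/-- Bound of the recovered step length by the optimal value, in terms of a nearly optimal dual
point. -/
theorem recoveredAlpha_le_refValue_add (h : D.IsRecovery R v r γ m₁ lam₁ ε s k n d)
    (hR : IsMultivariateConvexRiskMeasure R) (hX_ne : D.feasibleSet.Nonempty)
    (hv : v ∉ D.upperImage R) (hr : 0 < r) (hγ : 0 < γ) (hε : 0 < ε) {η : ℝ} (hη : 0 < η)
    {m : Fin I → Fin J → ℝ} {lam : Fin I → Fin M → ℝ} (hm : D.IsProper R m lam)
    (hopt : ∀ m' lam', D.IsProper R m' lam' →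
      D.dualObjective R v m' lam' ≤ D.dualObjective R v m lam + η) :
    recoveredAlpha D R v s n d ≤ D.refValue R v + (2 * ε + 4 * r * √(ε / r)
      + 2 * √(ε * (r * dualDist m m₁ lam lam₁
          + (D.refValue R v - D.dualObjective R v m₁ lam₁) / γ)
        + (D.refValue R v - D.dualObjective R v m₁ lam₁) / γ * η)
      + 2 * r * (√(ε / r) * √(pairing lam lam))) := by
  have h1 := h.recoveredAlpha_le hR hr m lam
  have hk := h.stopping.1
  have hkn := h.next.1
  have h2 := h.run.dualDist_center_le hR hr hγ hε hη (by lia) h.stopping hm hopt hk le_rfl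
  have h3 := (h.run.proper_center hk (by lia)).dualObjective_le_refValue hR hX_ne hv
  set Q := dualDist m (s.mbar k) lam (s.lambar k)
  set G := (D.refValue R v - D.dualObjective R v m₁ lam₁) / γ with hG
  have h4 : (D.dualObjective R v (s.mbar k) (s.lambar k) - D.dualObjective R v m₁ lam₁) / γ
      * (1 + η / ε) ≤ G * (1 + η / ε) :=
    mul_le_mul_of_nonneg_right (div_le_div_of_nonneg_right (by linarith) hγ.le) (by positivity)
  -- The factor `ε` from the step length cancels the `1 / ε` in the distance bound, leaving the
  -- residue `G * η`.
  have h5 : r * (√(ε / r) * √Q)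
      ≤ √(ε * (r * dualDist m m₁ lam lam₁ + G) + G * η) := by
    refine Real.le_sqrt_of_sq_le ?_
    rw [mul_pow, mul_pow, Real.sq_sqrt (by positivity), Real.sq_sqrt (dualDist_nonneg _ _ _ _)]
    calc r ^ 2 * (ε / r * Q) = ε * (r * Q) := by field_simp
      _ ≤ ε * (r * dualDist m m₁ lam lam₁ + G * (1 + η / ε)) :=
        mul_le_mul_of_nonneg_left (by linarith) hε.le
      _ = ε * (r * dualDist m m₁ lam lam₁ + G) + G * η := by field_simp; ring
  linarith

end IsRecovery

/-- The recovered step length is asymptotically at most the optimal value. -/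
theorem eventually_recoveredAlpha_lt (hR : IsMultivariateConvexRiskMeasure R)
    (hX_ne : D.feasibleSet.Nonempty) (hv : v ∉ D.upperImage R) (hr : 0 < r) (hγ : 0 < γ)
    (m₁ : Fin I → Fin J → ℝ) (lam₁ : Fin I → Fin M → ℝ) {δ : ℝ} (hδ : 0 < δ) :
    ∃ ε₀ : ℝ, 0 < ε₀ ∧
      ∀ (ε : ℝ) (s : BundleIterates I J M N) (k n : ℕ) (d : MasterMultipliers I J M),
        0 < ε → ε < ε₀ → D.IsRecovery R v r γ m₁ lam₁ ε s k n d →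
          recoveredAlpha D R v s n d < D.refValue R v + δ := by
  by_cases h₁ : D.IsProper R m₁ lam₁
  swap
  -- No run can start at an improper point, so the claim is vacuous.
  · refine ⟨1, one_pos, fun ε s k n d _ _ h => absurd ?_ h₁⟩
    have := h.run.proper (k := 1) le_rfl (by lia)
    rwa [h.run.start.1, h.run.start.2] at this
  let S : Set ℝ := {a | ∃ m lam, D.IsProper R m lam ∧ a = D.dualObjective R v m lam}
  have hS : BddAbove S := ⟨D.refValue R v, by
    rintro _ ⟨m, lam, hm, rfl⟩
    exact hm.dualObjective_le_refValue hR hX_ne hv⟩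
  set G := (D.refValue R v - D.dualObjective R v m₁ lam₁) / γ with hG
  have hG0 : 0 ≤ G :=
    div_nonneg (sub_nonneg.2 (h₁.dualObjective_le_refValue hR hX_ne hv)) hγ.le
  -- `η` depends only on `δ` and the data, and makes `2 * √(G * η) < δ`. The dual supremum need not
  -- be attained, so an `η`-optimal reference point is fixed before `ε`.
  set η := δ ^ 2 / (16 * (G + 1)) with hη
  have hη0 : 0 < η := by positivity
  obtain ⟨_, ⟨m, lam, hm, rfl⟩, hlt⟩ :=
    exists_lt_of_lt_csSup (s := S) ⟨_, m₁, lam₁, h₁, rfl⟩ (sub_lt_self (sSup S) hη0)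
  have hopt : ∀ m' lam', D.IsProper R m' lam' →
      D.dualObjective R v m' lam' ≤ D.dualObjective R v m lam + η := fun m' lam' hm' => by
    have := le_csSup hS ⟨m', lam', hm', rfl⟩
    linarith
  let φ : ℝ → ℝ := fun ε => 2 * ε + 4 * r * √(ε / r)
    + 2 * √(ε * (r * dualDist m m₁ lam lam₁ + G) + G * η) + 2 * r * (√(ε / r) * √(pairing lam lam))
  have hφ : Continuous φ := by fun_prop
  have hφ0 : φ 0 < δ := by
    have h2 : √(G * η) < δ / 2 := by
      rw [Real.sqrt_lt' (by positivity), hη, ← mul_div_assoc, div_lt_iff₀ (by positivity)]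
      nlinarith [sq_nonneg δ, pow_pos hδ 2, mul_nonneg hG0 (sq_nonneg δ)]
    simp only [φ, zero_div, Real.sqrt_zero, mul_zero, zero_mul, zero_add, add_zero]
    linarith
  obtain ⟨ε₀, hε₀, hball⟩ := Metric.eventually_nhds_iff.1
    (hφ.continuousAt.eventually (gt_mem_nhds hφ0))
  refine ⟨ε₀, hε₀, fun ε s k n d hε hεε h => ?_⟩
  have h3 := h.recoveredAlpha_le_refValue_add hR hX_ne hv hr hγ hε hη0 hm hopt
  have h4 : φ ε < δ := hball (by rwa [Real.dist_eq, sub_zero, abs_of_pos hε])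
  exact h3.trans_lt (add_lt_add_right h4 _)

/-- The recovered first-stage decisions are asymptotically nonanticipative. -/
theorem eventually_norm_recoveredX_sub_lt (hp : ∀ i, 0 < D.p i)
    (hR : IsMultivariateConvexRiskMeasure R) (hr : 0 < r)
    (m₁ : Fin I → Fin J → ℝ) (lam₁ : Fin I → Fin M → ℝ) {δ : ℝ} (hδ : 0 < δ) :
    ∃ ε₀ : ℝ, 0 < ε₀ ∧
      ∀ (ε : ℝ) (s : BundleIterates I J M N) (k n : ℕ) (d : MasterMultipliers I J M),
        0 < ε → ε < ε₀ → D.IsRecovery R v r γ m₁ lam₁ ε s k n d →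
          ∀ i, ‖recoveredX s n d i - d.sigma‖ < δ := by
  have h1 : ∀ i, ∀ᶠ ε in nhds (0 : ℝ), 2 * r * √(ε / r) / D.p i < δ := fun i => by
    have hφ : Continuous fun ε : ℝ => 2 * r * √(ε / r) / D.p i := by fun_prop
    exact hφ.continuousAt.eventually (gt_mem_nhds (by simpa using hδ))
  obtain ⟨ε₀, hε₀, hball⟩ := Metric.eventually_nhds_iff.1 (Filter.eventually_all.2 h1)
  refine ⟨ε₀, hε₀, fun ε s k n d hε hεε h i => ?_⟩
  exact (h.abs_recoveredX_sub_le hp hR hr i).trans_lt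
    (hball (by rwa [Real.dist_eq, sub_zero, abs_of_pos hε]) i)

end StochProgram
-- Combination of the two one-sided estimates.
theorem theorem5p10 {I J K L M N : ℕ} (hI : 2 ≤ I) (hJ : 1 ≤ J) (hK : 1 ≤ K) (hL : 1 ≤ L)
    (hM : 1 ≤ M) (hN : 1 ≤ N) (D : StochProgram I J K L M N)
    (hp : ∀ i, 0 < D.p i) (hp_sum : ∑ i, D.p i = 1)
    (R : (Fin I → Fin J → ℝ) → Set (Fin J → ℝ)) (hR : IsMultivariateConvexRiskMeasure R)
    (hX : IsCompact D.feasibleSet) (hX_ne : D.feasibleSet.Nonempty)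
    (v : Fin J → ℝ) (hv : v ∉ D.upperImage R)
    (r γ : ℝ) (hr : 0 < r) (hγ₀ : 0 < γ) (hγ₁ : γ < 1)
    (m₁ : Fin I → Fin J → ℝ) (lam₁ : Fin I → Fin M → ℝ) :
    -- the optimal value in the limit is a genuine finite infimum
    IsGLB (D.refValues R v) (D.refValue R v) ∧
    -- feasibility of the recovered point, for every tolerance
    (∀ (ε : ℝ) (s : BundleIterates I J M N) (k n : ℕ) (d : MasterMultipliers I J M), 0 < ε →
      D.IsRecovery R v r γ m₁ lam₁ ε s k n d →
        (∀ i, (recoveredX s n d i, recoveredY s n d i) ∈ D.scenarioSet i) ∧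
        (fun j => v j + recoveredAlpha D R v s n d) ∈
          R (D.cost (recoveredX s n d) (recoveredY s n d)) ∧
        IsLeast (D.steps R v (recoveredX s n d) (recoveredY s n d))
          (recoveredAlpha D R v s n d)) ∧
    -- the two limits as the tolerance tends to zero
    (∀ δ : ℝ, 0 < δ → ∃ ε₀ : ℝ, 0 < ε₀ ∧
      ∀ (ε : ℝ) (s : BundleIterates I J M N) (k n : ℕ) (d : MasterMultipliers I J M),
        0 < ε → ε < ε₀ → D.IsRecovery R v r γ m₁ lam₁ ε s k n d →
          (∀ i, ‖recoveredX s n d i - d.sigma‖ < δ) ∧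
          |recoveredAlpha D R v s n d - D.refValue R v| < δ) := by
  refine ⟨StochProgram.isGLB_refValue hR hX_ne hv, fun ε s k n d _ h => ?_, fun δ hδ => ?_⟩
  · have hleast := StochProgram.isLeast_sInf_steps (D := D) (v := v) hR
      (recoveredX s n d) (recoveredY s n d)
    exact ⟨h.mem_scenarioSet hR hr.le, hleast.1, hleast⟩
  · obtain ⟨c, hc, hlow⟩ := StochProgram.exists_refValue_sub_lt (by lia) hR hX.isBounded hX_ne hv hδ
    obtain ⟨ε₁, hε₁, H₁⟩ :=
      StochProgram.eventually_recoveredAlpha_lt hR hX_ne hv hr hγ₀ m₁ lam₁ hδ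
    -- Distance `c / 2` to `sigma` puts any two first stages within `c`, as the lower bound
    -- requires.
    obtain ⟨ε₂, hε₂, H₂⟩ := StochProgram.eventually_norm_recoveredX_sub_lt (v := v) (γ := γ) hp hR hr
      m₁ lam₁ (lt_min hδ (half_pos hc))
    refine ⟨min ε₁ ε₂, lt_min hε₁ hε₂, fun ε s k n d hε hεlt h => ?_⟩
    have h1 := H₁ ε s k n d hε (hεlt.trans_le (min_le_left _ _)) h
    have h2 := H₂ ε s k n d hε (hεlt.trans_le (min_le_right _ _)) h
    refine ⟨fun i => (h2 i).trans_le (min_le_left _ _), ?_⟩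
    have h3 := hlow (recoveredX s n d, recoveredY s n d)
      ⟨h.mem_scenarioSet hR hr.le, fun i j => by
        have e : recoveredX s n d i - recoveredX s n d j
          = (recoveredX s n d i - d.sigma) - (recoveredX s n d j - d.sigma) := by abel
        dsimp only
        rw [e]
        have := norm_sub_le (recoveredX s n d i - d.sigma) (recoveredX s n d j - d.sigma)
        have := (h2 i).trans_le (min_le_right _ _)
        have := (h2 j).trans_le (min_le_right _ _)
        linarith⟩ _ (StochProgram.isLeast_sInf_steps hR _ _).1
    rw [abs_lt]
    change D.refValue R v - δ < recoveredAlpha D R v s n d at h3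
    constructor <;> linarith
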